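/- **Setting.** Let $(m,n)$ be a pair of relatively prime non-negative integers and let $(\alpha_1,\alpha_2)\in\mathbb{C}^2$ be a nonzero vector with $m\alpha_1+n\alpha_2=0$ (for instance $(-n,m)$). Put $F=\mathbb{Z}\alpha_1+\mathbb{Z}\alpha_2$ (the face lattice), $V=F+(\alpha_1+\alpha_2)/2$ and $E_i=F+\alpha_i/2$ for $i=1,2$. Let $\mathscr{L}=(\mathscr{L}_1,\mathscr{L}_2)$ be a pair of functions $\mathscr{L}_i:E_i\to\mathbb{Z}_{\ge 0}$ with finite support such that for every $v\in V$ $$\mathscr{L}_1(v-\alpha_2/2)+\mathscr{L}_2(v-\alpha_1/2)=\mathscr{L}_1(v+\alpha_2/2)+\mathscr{L}_2(v+\alpha_1/2),$$ and put $P_i(u)=\prod_{e\in E_i}(u-e)^{\mathscr{L}_i(e)}\in\mathbb{C}[u]$. Let $\tilde{\mathcal{A}}$ be the associative $\mathbb{C}$-algebra with generators $H,X_1^\pm,X_2^\pm$ and relations $$HX_i^\pm-X_i^\pm H=\pm\alpha_iX_i^\pm,\qquad X_i^\pm X_i^\mp=P_i\big(H\mp\tfrac{\alpha_i}{2}\big),\qquad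 X_i^\pm X_j^\mp=X_j^\mp X_i^\pm\ (i\neq j),$$ and let $\mathcal{A}=\mathcal{A}(\mathscr{L})$ be the quotient of $\tilde{\mathcal{A}}$ by the ideal of all $a$ such that $f(H)a=0$ for some nonzero $f\in\mathbb{C}[u]$. It is $\mathbb{Z}^2$-graded by $\deg H=0$, $\deg X_i^\pm=\pm\mathbf{e}_i$, and its degree zero component is $\mathbb{C}[H]$, a polynomial algebra in $H$. Let $*$ be the anti-automorphism of $\mathcal{A}$ with $H^*=H$, $(X_i^\pm)^*=X_i^\mp$. Let $\mathcal{C}=C_{\mathcal{A}}(H)$ be the centralizer of $H$ in $\mathcal{A}$, and for $\lambda\in F$ let $\mathcal{C}_\lambda=\mathcal{C}/(H-\lambda)$ with the inherited gradation. Its gradation radical is $$\mathcal{J}_\lambda=\{x\in\mathcal{C}_\lambda\mid \mathrm{Proj}_0(xy)=0=\mathrm{Proj}_0(yx)\ \text{for all}\ y\in\mathcal{C}_\lambda\},$$ where $\mathrm{Proj}_0$ is the projection onto the component of degree zero. An $\mathcal{A}$-module $M$ is a weight module if $M=\bigoplus_{\mu\in\mathbb{C}}M_\mu$, where $M_\mu=\{v\in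 M\mid Hv=\mu v\}$. A simple weight module $M$ has no inner breaks if for every $\mu\in\mathbb{C}$ with $M_\mu\neq0$ and every monomial $a=r(H)X_{i_1}^{\varepsilon_1}\cdots X_{i_k}^{\varepsilon_k}$ ($r\in\mathbb{C}[u]$, $i_j\in\{1,2\}$, $\varepsilon_j\in\{+,-\}$) with $aM_\mu\neq0$, the element $a^*a\in\mathbb{C}[H]$ does not lie in the ideal $(H-\mu)$ of $\mathbb{C}[H]$. **Theorem.** 1. For every $\lambda\in F$, the algebra $\mathcal{C}_\lambda$ is commutative and its gradation radical $\mathcal{J}_\lambda$ is equal to its nilradical, the set of nilpotent elements of $\mathcal{C}_\lambda$. In particular $\mathcal{J}_\lambda$ is nil. 2. Every simple weight $\mathcal{A}(\mathscr{L})$-module has no inner breaks. -/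

import Mathlib

open Polynomial

noncomputable section

namespace KleinianFiber

section Graded

variable {ι D : Type*} [DecidableEq ι] [AddMonoid ι] [Ring D]

/-- The gradation form `γ(x, y) = Proj_e (x y)` of a graded algebra (the gradation group is written
additively, so its identity `e` is `0`). -/
def gradationForm [Algebra ℂ D] (𝒟 : ι → Submodule ℂ D) [GradedAlgebra 𝒟] (x y : D) : D :=
  GradedAlgebra.proj 𝒟 0 (x * y)

/-- The gradation radical of a graded algebra: the radical of the gradation form. -/
def gradationRadical [Algebra ℂ D] (𝒟 : ι → Submodule ℂ D) [GradedAlgebra 𝒟] : Set D :=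
  {x | ∀ y, gradationForm 𝒟 x y = 0 ∧ gradationForm 𝒟 y x = 0}

/-- A decomposition built from a linear family of projections. -/
abbrev decompositionOfProj {V : Type*} [AddCommGroup V] [Module ℂ V] (𝒟 : ι → Submodule ℂ V)
    (π : V → (ι →₀ V)) (h₁ : ∀ x i, π x i ∈ 𝒟 i) (h₂ : ∀ x, ((π x).sum fun _ y => y) = x)
    (hadd : ∀ x y, π (x + y) = π x + π y)
    (h₃ : ∀ i, ∀ x ∈ 𝒟 i, π x = Finsupp.single i x) : DirectSum.Decomposition 𝒟 where
  decompose' x := ∑ i ∈ (π x).support, DirectSum.of (fun i => 𝒟 i) i ⟨π x i, h₁ x i⟩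
  left_inv x := by
    rw [map_sum]
    simp only [DirectSum.coeAddMonoidHom_of]
    exact h₂ x
  right_inv x := by
    have key : ∀ (x : V) (j : ι), ((∑ i ∈ (π x).support,
        DirectSum.of (fun i => 𝒟 i) i ⟨π x i, h₁ x i⟩ : DirectSum ι fun i => 𝒟 i) j : V)
          = π x j := by
      intro x j
      by_cases hj : π x j = 0
      · rw [DFinsupp.finsetSum_apply, AddSubmonoidClass.coe_finsetSum, hj]
        refine Finset.sum_eq_zero fun i hi => ?_
        have : i ≠ j := by rintro rfl; exact (Finsupp.mem_support_iff.mp hi) hj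
        rw [DirectSum.of_eq_of_ne _ _ _ this.symm]; rfl
      · rw [DFinsupp.finsetSum_apply, AddSubmonoidClass.coe_finsetSum,
          Finset.sum_eq_single j]
        · rw [DirectSum.of_eq_same]
        · intro i _ hij
          rw [DirectSum.of_eq_of_ne _ _ _ hij.symm]; rfl
        · intro h; exact absurd (Finsupp.mem_support_iff.mpr hj) h
    refine DFinsupp.ext fun j => Subtype.ext ?_
    rw [key]
    have hzero : π 0 = 0 := by simpa using hadd 0 0
    induction x using DirectSum.induction_on with
    | zero => simp [hzero]
    | of i y =>
      rw [DirectSum.coeAddMonoidHom_of, h₃ i _ y.2]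
      by_cases hij : i = j
      · subst hij; simp
      · rw [DirectSum.of_eq_of_ne _ _ _ (Ne.symm hij)]
        simp [hij]
    | add x y hx hy =>
      rw [map_add, hadd, Finsupp.add_apply, hx, hy]; rfl

variable [Algebra ℂ D] (𝒟 : ι → Submodule ℂ D) [GradedAlgebra 𝒟]

/-- The projections onto the homogeneous components as a finitely supported function. -/
def projFinsupp (x : D) : ι →₀ D :=
  Finsupp.ofSupportFinite (fun i => GradedAlgebra.proj 𝒟 i x) (by
    classical
    refine ((DirectSum.decompose 𝒟 x).support.finite_toSet).subset fun i hi => ?_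
    simpa [GradedAlgebra.mem_support_iff] using hi)

theorem projFinsupp_apply (x : D) (i : ι) : projFinsupp 𝒟 x i = GradedAlgebra.proj 𝒟 i x := rfl

theorem projFinsupp_add (x y : D) :
    projFinsupp 𝒟 (x + y) = projFinsupp 𝒟 x + projFinsupp 𝒟 y := by
  ext i; simp [projFinsupp_apply]

theorem projFinsupp_sum (x : D) : ((projFinsupp 𝒟 x).sum fun _ y => y) = x := by
  classical
  conv_rhs => rw [← DirectSum.sum_support_decompose 𝒟 x]
  refine Finset.sum_congr ?_ fun i _ => rfl
  ext i
  rw [Finsupp.mem_support_iff, GradedAlgebra.mem_support_iff]; rfl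

theorem projFinsupp_of_mem {i : ι} {x : D} (hx : x ∈ 𝒟 i) :
    projFinsupp 𝒟 x = Finsupp.single i x := by
  ext j
  rw [projFinsupp_apply, GradedAlgebra.proj_apply]
  by_cases h : i = j
  · subst h; simp [DirectSum.decompose_of_mem_same 𝒟 hx]
  · rw [DirectSum.decompose_of_mem_ne 𝒟 hx h]; simp [h]

/-- The gradation inherited by the quotient by an ideal. -/
def quotientGrading (I : Ideal D) [I.IsTwoSided] (i : ι) : Submodule ℂ (D ⧸ I) :=
  (𝒟 i).map (Ideal.Quotient.mkₐ ℂ I).toLinearMap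

/-- The gradation inherited by a subalgebra. -/
def subalgebraGrading (S : Subalgebra ℂ D) (i : ι) : Submodule ℂ S :=
  (𝒟 i).comap S.val.toLinearMap

theorem proj_mem_of_homogeneous {I : Ideal D} (hI : I.IsHomogeneous 𝒟) {x : D} (hx : x ∈ I)
    (i : ι) : GradedAlgebra.proj 𝒟 i x ∈ I := hI i hx

/-- The quotient of a graded algebra by a homogeneous ideal is graded. -/
abbrev quotientGradedAlgebra (I : Ideal D) [I.IsTwoSided] (hI : I.IsHomogeneous 𝒟) :
    GradedAlgebra (quotientGrading 𝒟 I) where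
  one_mem := ⟨1, SetLike.GradedOne.one_mem, map_one (Ideal.Quotient.mkₐ ℂ I)⟩
  mul_mem := by
    rintro i j _ _ ⟨x, hx, rfl⟩ ⟨y, hy, rfl⟩
    exact ⟨x * y, SetLike.GradedMul.mul_mem hx hy, map_mul (Ideal.Quotient.mkₐ ℂ I) x y⟩
  toDecomposition := by
    have hwd : ∀ x y : D, Ideal.Quotient.mk I x = Ideal.Quotient.mk I y →
        (projFinsupp 𝒟 x).mapRange (Ideal.Quotient.mk I) (map_zero _)
          = (projFinsupp 𝒟 y).mapRange (Ideal.Quotient.mk I) (map_zero _) := by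
      intro x y h
      ext i
      rw [Finsupp.mapRange_apply, Finsupp.mapRange_apply, Ideal.Quotient.eq,
        projFinsupp_apply, projFinsupp_apply, ← map_sub]
      exact hI i (Ideal.Quotient.eq.mp h)
    have hout : ∀ x : D, (projFinsupp 𝒟 (Function.surjInv Ideal.Quotient.mk_surjective
        (Ideal.Quotient.mk I x))).mapRange (Ideal.Quotient.mk I) (map_zero _)
          = (projFinsupp 𝒟 x).mapRange (Ideal.Quotient.mk I) (map_zero _) := fun x =>
      hwd _ _ (Function.surjInv_eq Ideal.Quotient.mk_surjective _)
    refine decompositionOfProj (quotientGrading 𝒟 I)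
      (fun q => (projFinsupp 𝒟 (Function.surjInv Ideal.Quotient.mk_surjective q)).mapRange
        (Ideal.Quotient.mk I) (map_zero _)) ?_ ?_ ?_ ?_
    · intro q i
      exact ⟨_, SetLike.coe_mem (DirectSum.decompose 𝒟 (Function.surjInv
        (Ideal.Quotient.mk_surjective (I := I)) q) i), rfl⟩
    · intro q
      obtain ⟨x, rfl⟩ := Ideal.Quotient.mk_surjective q
      rw [hout, Finsupp.sum_mapRange_index (fun _ => rfl)]
      conv_rhs => rw [← projFinsupp_sum 𝒟 x]
      rw [Finsupp.sum, Finsupp.sum, map_sum]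
    · intro q r
      obtain ⟨x, rfl⟩ := Ideal.Quotient.mk_surjective q
      obtain ⟨y, rfl⟩ := Ideal.Quotient.mk_surjective r
      rw [← map_add, hout, hout, hout, projFinsupp_add]
      exact Finsupp.mapRange_add (map_add _) _ _
    · rintro i _ ⟨x, hx, rfl⟩
      refine (hout x).trans ?_
      rw [projFinsupp_of_mem 𝒟 hx, Finsupp.mapRange_single]
      rfl

/-- A subalgebra containing the homogeneous components of its elements is graded. -/
abbrev subalgebraGradedAlgebra (S : Subalgebra ℂ D)
    (hS : ∀ x ∈ S, ∀ i, GradedAlgebra.proj 𝒟 i x ∈ S) :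
    GradedAlgebra (subalgebraGrading 𝒟 S) where
  one_mem := SetLike.GradedOne.one_mem (A := 𝒟)
  mul_mem := fun _ _ _ _ hx hy => SetLike.GradedMul.mul_mem (A := 𝒟) hx hy
  toDecomposition := by
    let π : S → (ι →₀ S) := fun x => Finsupp.ofSupportFinite
      (fun i => (⟨GradedAlgebra.proj 𝒟 i x, hS x x.2 i⟩ : S)) (by
        refine (projFinsupp 𝒟 (x : D)).hasFiniteSupport.subset fun i hi => ?_
        intro h0
        exact hi (Subtype.ext h0))
    have hπ : ∀ x i, ((π x i : S) : D) = GradedAlgebra.proj 𝒟 i x := fun _ _ => rfl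
    refine decompositionOfProj (subalgebraGrading 𝒟 S) π ?_ ?_ ?_ ?_
    · intro x i
      exact SetLike.coe_mem (DirectSum.decompose 𝒟 (x : D) i)
    · intro x
      apply Subtype.ext
      conv_rhs => rw [← projFinsupp_sum 𝒟 (x : D)]
      rw [Finsupp.sum, Finsupp.sum, AddSubmonoidClass.coe_finsetSum]
      refine Finset.sum_congr ?_ fun i _ => rfl
      ext i
      rw [Finsupp.mem_support_iff, Finsupp.mem_support_iff, Ne, Ne, Subtype.ext_iff]; rfl
    · intro x y
      ext i
      simp [hπ]
    · intro i x hx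
      ext j
      rw [hπ, ← projFinsupp_apply, projFinsupp_of_mem 𝒟 (show (x : D) ∈ 𝒟 i from hx)]
      by_cases h : i = j
      · subst h; simp
      · simp [h]

end Graded

/-- The generators `H` and `X_i^ε` (`i = 0, 1`; `ε = ±1`). -/
inductive Gen
  | H
  | X (i : Fin 2) (ε : ℤˣ)

/-- The generators as elements of the free algebra. -/
abbrev freeH : FreeAlgebra ℂ Gen := FreeAlgebra.ι ℂ Gen.H

/-- The generators as elements of the free algebra. -/
abbrev freeX (i : Fin 2) (ε : ℤˣ) : FreeAlgebra ℂ Gen := FreeAlgebra.ι ℂ (Gen.X i ε)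

/-- A sign `ε = ±1` as a complex number. -/
abbrev sgn (ε : ℤˣ) : ℂ := ((ε : ℤ) : ℂ)

/-- The defining relations, both signs treated at once:
`H X_i^ε - X_i^ε H = ε α_i X_i^ε`, `X_i^ε X_i^{-ε} = p_i(H - ε α_i / 2)`, and
`X_i^ε X_j^{-ε} = X_j^{-ε} X_i^ε` for `i ≠ j`. -/
inductive Rel (α : Fin 2 → ℂ) (p : Fin 2 → ℂ[X]) : FreeAlgebra ℂ Gen → FreeAlgebra ℂ Gen → Prop
  | weight (i : Fin 2) (ε : ℤˣ) :
      Rel α p (freeH * freeX i ε - freeX i ε * freeH) ((sgn ε * α i) • freeX i ε)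
  | mul (i : Fin 2) (ε : ℤˣ) :
      Rel α p (freeX i ε * freeX i (-ε))
        (aeval (freeH - algebraMap ℂ _ (sgn ε * α i / 2)) (p i))
  | comm (i j : Fin 2) (ε : ℤˣ) (hij : i ≠ j) :
      Rel α p (freeX i ε * freeX j (-ε)) (freeX j (-ε) * freeX i ε)

/-- The algebra `Ã` with the above generators and relations. -/
abbrev PreAlg (α : Fin 2 → ℂ) (p : Fin 2 → ℂ[X]) : Type := RingQuot (Rel α p)

section Pre

variable (α : Fin 2 → ℂ) (p : Fin 2 → ℂ[X])

/-- A generator as an element of `Ã`. -/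
def preGen (g : Gen) : PreAlg α p := RingQuot.mkAlgHom ℂ (Rel α p) (FreeAlgebra.ι ℂ g)

theorem pre_weight (i : Fin 2) (ε : ℤˣ) :
    preGen α p .H * preGen α p (.X i ε) - preGen α p (.X i ε) * preGen α p .H
      = (sgn ε * α i) • preGen α p (.X i ε) := by
  simpa [preGen] using RingQuot.mkAlgHom_rel ℂ (Rel.weight (α := α) (p := p) i ε)

theorem pre_mul (i : Fin 2) (ε : ℤˣ) :
    preGen α p (.X i ε) * preGen α p (.X i (-ε))
      = aeval (preGen α p .H - algebraMap ℂ _ (sgn ε * α i / 2)) (p i) := by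
  have := RingQuot.mkAlgHom_rel ℂ (Rel.mul (α := α) (p := p) i ε)
  rw [map_mul, ← Polynomial.aeval_algHom_apply, map_sub, AlgHom.commutes] at this
  exact this

theorem pre_comm (i j : Fin 2) (ε : ℤˣ) (hij : i ≠ j) :
    preGen α p (.X i ε) * preGen α p (.X j (-ε))
      = preGen α p (.X j (-ε)) * preGen α p (.X i ε) := by
  simpa [preGen] using RingQuot.mkAlgHom_rel ℂ (Rel.comm (α := α) (p := p) i j ε hij)

variable {α p} in
theorem pre_induction {P : PreAlg α p → Prop} (halg : ∀ c : ℂ, P (algebraMap ℂ _ c))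
    (hgen : ∀ g, P (preGen α p g)) (hadd : ∀ x y, P x → P y → P (x + y))
    (hmul : ∀ x y, P x → P y → P (x * y)) (x : PreAlg α p) : P x := by
  obtain ⟨y, rfl⟩ := RingQuot.mkAlgHom_surjective ℂ (Rel α p) x
  induction y using FreeAlgebra.induction with
  | grade0 r => rw [AlgHom.commutes]; exact halg r
  | grade1 g => exact hgen g
  | mul a b ha hb => rw [map_mul]; exact hmul _ _ ha hb
  | add a b ha hb => rw [map_add]; exact hadd _ _ ha hb

/-- The degrees of the generators: `deg H = 0`, `deg X_i^± = ± e_i`. -/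
def genDeg : Gen → (Fin 2 → ℤ)
  | .H => 0
  | .X i ε => Pi.single i (ε : ℤ)

/-- The homogeneous component `Ã_g`: the span of the words of degree `g` in the generators. -/
def preGrading (g : Fin 2 → ℤ) : Submodule ℂ (PreAlg α p) :=
  Submodule.span ℂ {a | ∃ w : List Gen, (w.map genDeg).sum = g ∧ (w.map (preGen α p)).prod = a}

/-- The algebra homomorphism `Ã → Ã[ℤ²]` sending a homogeneous `a` to `a` times the group element
of its degree; it is used to show that the components of `Ã` form a direct sum. -/
def coaction : PreAlg α p →ₐ[ℂ] AddMonoidAlgebra (PreAlg α p) (Fin 2 → ℤ) :=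
  RingQuot.liftAlgHom ℂ (s := Rel α p)
    ⟨FreeAlgebra.lift ℂ fun g => AddMonoidAlgebra.single (genDeg g) (preGen α p g), by
      intro x y h
      induction h with
      | weight i ε =>
        simp only [map_sub, map_mul, FreeAlgebra.lift_ι_apply, AddMonoidAlgebra.single_mul_single,
          genDeg, zero_add, add_zero, map_smul, AddMonoidAlgebra.smul_single]
        rw [← pre_weight, AddMonoidAlgebra.single_sub]
      | mul i ε =>
        rw [map_mul, ← Polynomial.aeval_algHom_apply, map_sub, AlgHom.commutes]
        simp only [FreeAlgebra.lift_ι_apply, AddMonoidAlgebra.single_mul_single]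
        have h0 : genDeg (.X i ε) + genDeg (.X i (-ε)) = 0 := by
          simp [genDeg, ← Pi.single_add]
        have h1 : (AddMonoidAlgebra.single (genDeg .H) (preGen α p .H)
            - algebraMap ℂ _ (sgn ε * α i / 2) :
              AddMonoidAlgebra (PreAlg α p) (Fin 2 → ℤ))
            = (AddMonoidAlgebra.singleZeroAlgHom (R := ℂ) :
                PreAlg α p →ₐ[ℂ] AddMonoidAlgebra (PreAlg α p) (Fin 2 → ℤ))
              (preGen α p .H - algebraMap ℂ _ (sgn ε * α i / 2)) := by
          rw [map_sub, AlgHom.commutes]; rfl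
        rw [h0, h1, Polynomial.aeval_algHom_apply, pre_mul]; rfl
      | comm i j ε hij =>
        simp only [map_mul, FreeAlgebra.lift_ι_apply, AddMonoidAlgebra.single_mul_single]
        rw [pre_comm α p i j ε hij, add_comm]⟩

theorem coaction_gen (g : Gen) :
    coaction α p (preGen α p g) = AddMonoidAlgebra.single (genDeg g) (preGen α p g) := by
  rw [coaction, preGen, RingQuot.liftAlgHom_mkAlgHom_apply, FreeAlgebra.lift_ι_apply]; rfl

theorem coaction_word (w : List Gen) :
    coaction α p (w.map (preGen α p)).prod
      = AddMonoidAlgebra.single (w.map genDeg).sum (w.map (preGen α p)).prod := by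
  induction w with
  | nil => simp [AddMonoidAlgebra.one_def]
  | cons g w ih =>
    simp [coaction_gen, ih, AddMonoidAlgebra.single_mul_single]

theorem coaction_of_mem {g : Fin 2 → ℤ} {a : PreAlg α p} (ha : a ∈ preGrading α p g) :
    coaction α p a = AddMonoidAlgebra.single g a := by
  induction ha using Submodule.span_induction with
  | mem x hx => obtain ⟨w, rfl, rfl⟩ := hx; exact coaction_word α p w
  | zero => simp
  | add x y _ _ hx hy => rw [map_add, hx, hy, AddMonoidAlgebra.single_add]
  | smul c x _ hx => rw [map_smul, hx, AddMonoidAlgebra.smul_single]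

instance preGradedMonoid : SetLike.GradedMonoid (preGrading α p) where
  one_mem := Submodule.subset_span ⟨[], by simp, by simp⟩
  mul_mem := by
    intro i j x y hx hy
    have := Submodule.mul_mem_mul hx hy
    rw [preGrading, preGrading, Submodule.span_mul_span] at this
    refine Submodule.span_mono ?_ this
    rintro _ ⟨_, ⟨w, rfl, rfl⟩, _, ⟨v, rfl, rfl⟩, rfl⟩
    exact ⟨w ++ v, by simp, by simp⟩

theorem gen_mem (g : Gen) : preGen α p g ∈ preGrading α p (genDeg g) :=
  Submodule.subset_span ⟨[g], by simp, by simp⟩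

theorem pre_span_words (a : PreAlg α p) :
    a ∈ Submodule.span ℂ (Set.range fun w : List Gen => (w.map (preGen α p)).prod) := by
  induction a using pre_induction with
  | halg c =>
    rw [Algebra.algebraMap_eq_smul_one]
    exact Submodule.smul_mem _ _ (Submodule.subset_span ⟨[], by simp⟩)
  | hgen g => exact Submodule.subset_span ⟨[g], by simp⟩
  | hadd x y hx hy => exact Submodule.add_mem _ hx hy
  | hmul x y hx hy =>
    have := Submodule.mul_mem_mul hx hy
    rw [Submodule.span_mul_span] at this
    refine Submodule.span_mono ?_ this
    rintro _ ⟨_, ⟨w, rfl⟩, _, ⟨v, rfl⟩, rfl⟩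
    exact ⟨w ++ v, by simp⟩

theorem coaction_coeff_mem (a : PreAlg α p) (g : Fin 2 → ℤ) :
    (coaction α p a).coeff g ∈ preGrading α p g := by
  induction pre_span_words α p a using Submodule.span_induction with
  | mem x hx =>
    obtain ⟨w, rfl⟩ := hx
    simp only [coaction_word, AddMonoidAlgebra.coeff_single]
    by_cases h : (w.map genDeg).sum = g
    · subst h
      rw [Finsupp.single_eq_same]
      exact Submodule.subset_span ⟨w, rfl, rfl⟩
    · rw [Finsupp.single_apply, if_neg h]
      exact Submodule.zero_mem _
  | zero => simp
  | add x y _ _ hx hy => rw [map_add]; exact Submodule.add_mem _ hx hy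
  | smul c x _ hx => rw [map_smul]; exact Submodule.smul_mem _ c hx

theorem coaction_sum (a : PreAlg α p) : ((coaction α p a).coeff.sum fun _ y => y) = a := by
  induction pre_span_words α p a using Submodule.span_induction with
  | mem x hx =>
    obtain ⟨w, rfl⟩ := hx
    simp [coaction_word, AddMonoidAlgebra.coeff_single]
  | zero => simp
  | add x y _ _ hx hy =>
    rw [map_add, AddMonoidAlgebra.coeff_add,
      Finsupp.sum_add_index' (fun _ => rfl) (fun _ _ _ => rfl), hx, hy]
  | smul c x _ hx =>
    rw [map_smul, AddMonoidAlgebra.coeff_smul, Finsupp.sum_smul_index' (fun _ => rfl),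
      ← Finsupp.smul_sum, hx]

instance preGradedAlgebra : GradedAlgebra (preGrading α p) where
  toDecomposition := decompositionOfProj (preGrading α p) (fun a => (coaction α p a).coeff)
    (coaction_coeff_mem α p) (coaction_sum α p)
    (fun x y => by rw [map_add, AddMonoidAlgebra.coeff_add])
    (fun i x hx => by rw [coaction_of_mem α p hx, AddMonoidAlgebra.coeff_single])

/-- The homomorphism `f ↦ f(H)` from `ℂ[u]` to `Ã`. -/
abbrev preEval : ℂ[X] →ₐ[ℂ] PreAlg α p := aeval (preGen α p .H)

theorem pre_H_mul_X (i : Fin 2) (ε : ℤˣ) :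
    preGen α p .H * preGen α p (.X i ε)
      = preGen α p (.X i ε) * (preGen α p .H + algebraMap ℂ _ (sgn ε * α i)) := by
  rw [mul_add, ← Algebra.commutes, ← Algebra.smul_def, ← pre_weight]; abel

theorem preEval_shift (i : Fin 2) (ε : ℤˣ) (f : ℂ[X]) :
    preEval α p f * preGen α p (.X i ε)
      = preGen α p (.X i ε) * preEval α p (f.comp (X + C (sgn ε * α i))) := by
  induction f using Polynomial.induction_on' with
  | add f g hf hg => simp only [map_add, add_mul, mul_add, add_comp, hf, hg]
  | monomial k c =>
    have hk : ∀ k : ℕ, preGen α p .H ^ k * preGen α p (.X i ε)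
        = preGen α p (.X i ε) * (preGen α p .H + algebraMap ℂ _ (sgn ε * α i)) ^ k := by
      intro k
      induction k with
      | zero => simp
      | succ k ih => rw [pow_succ, mul_assoc, pre_H_mul_X, ← mul_assoc, ih, mul_assoc, ← pow_succ]
    rw [monomial_comp, aeval_monomial, mul_assoc, hk, map_mul (preEval α p), map_pow (preEval α p),
      map_add (preEval α p), aeval_X, aeval_C, aeval_C, ← mul_assoc, ← mul_assoc,
      Algebra.commutes]

/-- The ideal `ℐ` of all `a ∈ Ã` with `f(H) a = 0` for some nonzero polynomial `f`. -/
def torsionIdeal : Ideal (PreAlg α p) where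
  carrier := {a | ∃ f : ℂ[X], f ≠ 0 ∧ preEval α p f * a = 0}
  zero_mem' := ⟨1, one_ne_zero, by simp⟩
  add_mem' := by
    rintro a b ⟨f, hf, ha⟩ ⟨g, hg, hb⟩
    refine ⟨f * g, mul_ne_zero hf hg, ?_⟩
    rw [mul_add]
    conv_lhs => arg 1; rw [mul_comm f g]
    rw [map_mul, map_mul, mul_assoc, ha, mul_assoc, hb, mul_zero, mul_zero, add_zero]
  smul_mem' := by
    intro b
    have hadd : ∀ x y : PreAlg α p, (∃ f : ℂ[X], f ≠ 0 ∧ preEval α p f * x = 0) →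
        (∃ f : ℂ[X], f ≠ 0 ∧ preEval α p f * y = 0) →
        ∃ f : ℂ[X], f ≠ 0 ∧ preEval α p f * (x + y) = 0 := by
      rintro a b ⟨f, hf, ha⟩ ⟨g, hg, hb⟩
      refine ⟨f * g, mul_ne_zero hf hg, ?_⟩
      rw [mul_add]
      conv_lhs => arg 1; rw [mul_comm f g]
      rw [map_mul, map_mul, mul_assoc, ha, mul_assoc, hb, mul_zero, mul_zero, add_zero]
    change ∀ {x : PreAlg α p}, (∃ f : ℂ[X], f ≠ 0 ∧ preEval α p f * x = 0) →
      ∃ f : ℂ[X], f ≠ 0 ∧ preEval α p f * (b * x) = 0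
    induction b using pre_induction with
    | halg c =>
      rintro a ⟨f, hf, ha⟩
      refine ⟨f, hf, ?_⟩
      rw [← mul_assoc, ← Algebra.commutes, mul_assoc, ha, mul_zero]
    | hgen g =>
      rintro a ⟨f, hf, ha⟩
      cases g with
      | H =>
        refine ⟨f, hf, ?_⟩
        have : preEval α p f * preGen α p .H = preGen α p .H * preEval α p f := by
          have h := congrArg (preEval α p) (mul_comm f X)
          simpa using h
        rw [← mul_assoc, this, mul_assoc, ha, mul_zero]
      | X i ε =>
        refine ⟨f.comp (X - C (sgn ε * α i)), ?_, ?_⟩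
        · intro h0
          apply hf
          have := congrArg (fun q => q.comp (X + C (sgn ε * α i))) h0
          simpa [comp_assoc] using this
        · rw [← mul_assoc, preEval_shift, comp_assoc]
          simp [mul_assoc, ha]
    | hadd x y hx hy =>
      intro a ha
      rw [add_mul]
      exact hadd _ _ (hx ha) (hy ha)
    | hmul x y hx hy =>
      intro a ha
      rw [mul_assoc]
      exact hx (hy ha)

instance torsionIdeal_isTwoSided : (torsionIdeal α p).IsTwoSided where
  mul_mem_of_left := by
    rintro a b ⟨f, hf, ha⟩
    exact ⟨f, hf, by rw [← mul_assoc, ha, zero_mul]⟩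

theorem preEval_mem (f : ℂ[X]) : preEval α p f ∈ preGrading α p 0 := by
  have hH : preGen α p .H ∈ SetLike.GradeZero.subalgebra (preGrading α p) := gen_mem α p .H
  exact (aeval (⟨_, hH⟩ : SetLike.GradeZero.subalgebra (preGrading α p)) f).2 |> fun h => by
    have e : preEval α p f
        = (SetLike.GradeZero.subalgebra (preGrading α p)).val
          (aeval (⟨_, hH⟩ : SetLike.GradeZero.subalgebra (preGrading α p)) f) := by
      rw [← Polynomial.aeval_algHom_apply]; rfl
    rw [e]; exact h

theorem torsionIdeal_isHomogeneous : (torsionIdeal α p).IsHomogeneous (preGrading α p) := by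
  rintro i a ⟨f, hf, ha⟩
  refine ⟨f, hf, ?_⟩
  rw [← DirectSum.coe_decompose_mul_of_left_mem_zero (preGrading α p) (preEval_mem α p f), ha]
  simp

end Pre

section Main

variable (α : Fin 2 → ℂ) (p : Fin 2 → ℂ[X])

/-- The noncommutative Kleinian fiber product `𝒜_{α₁,α₂}(p₁,p₂) = Ã / ℐ`. -/
abbrev Alg : Type := PreAlg α p ⧸ torsionIdeal α p

/-- The generator `H` of `𝒜`. -/
def genH : Alg α p := Ideal.Quotient.mkₐ ℂ (torsionIdeal α p) (preGen α p .H)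

/-- The generators `X_i^ε` of `𝒜`. -/
def genX (i : Fin 2) (ε : ℤˣ) : Alg α p :=
  Ideal.Quotient.mkₐ ℂ (torsionIdeal α p) (preGen α p (.X i ε))

/-- The `ℤ²`-gradation of `𝒜`, with `deg H = 0` and `deg X_i^± = ± e_i`. -/
abbrev grading : (Fin 2 → ℤ) → Submodule ℂ (Alg α p) :=
  quotientGrading (preGrading α p) (torsionIdeal α p)

instance gradedAlgebra : GradedAlgebra (grading α p) :=
  quotientGradedAlgebra (preGrading α p) (torsionIdeal α p) (torsionIdeal_isHomogeneous α p)

theorem genH_mem : genH α p ∈ grading α p 0 := ⟨_, gen_mem α p .H, rfl⟩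

/-- The cyclic subalgebra `𝒞`, the centralizer of `H` in `𝒜`. -/
abbrev cyclicSubalgebra : Subalgebra ℂ (Alg α p) := Subalgebra.centralizer ℂ {genH α p}

theorem cyclicSubalgebra_proj_mem (x : Alg α p) (hx : x ∈ cyclicSubalgebra α p) (i : Fin 2 → ℤ) :
    GradedAlgebra.proj (grading α p) i x ∈ cyclicSubalgebra α p := by
  rw [Subalgebra.mem_centralizer_iff] at hx ⊢
  rintro _ rfl
  have h := hx _ rfl
  rw [GradedAlgebra.proj_apply,
    ← DirectSum.coe_decompose_mul_of_left_mem_zero (grading α p) (genH_mem α p), h,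
    DirectSum.coe_decompose_mul_of_right_mem_zero (grading α p) (genH_mem α p)]

instance cyclicSubalgebra_gradedAlgebra :
    GradedAlgebra (subalgebraGrading (grading α p) (cyclicSubalgebra α p)) :=
  subalgebraGradedAlgebra (grading α p) (cyclicSubalgebra α p) (cyclicSubalgebra_proj_mem α p)

/-- The element `H - μ` of the cyclic subalgebra. -/
def cyclicElt (μ : ℂ) : cyclicSubalgebra α p :=
  ⟨genH α p - algebraMap ℂ _ μ, Subalgebra.sub_mem _
    ((Subalgebra.mem_centralizer_iff ℂ).mpr (by rintro _ rfl; rfl)) (Subalgebra.algebraMap_mem _ μ)⟩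

theorem cyclicElt_mem (μ : ℂ) :
    cyclicElt α p μ ∈ subalgebraGrading (grading α p) (cyclicSubalgebra α p) 0 :=
  Submodule.sub_mem _ (genH_mem α p) (SetLike.algebraMap_mem_graded (grading α p) μ)

theorem cyclicElt_central (μ : ℂ) (x : cyclicSubalgebra α p) :
    cyclicElt α p μ * x = x * cyclicElt α p μ := by
  apply Subtype.ext
  have h := (Subalgebra.mem_centralizer_iff ℂ).mp x.2 _ rfl
  change (genH α p - algebraMap ℂ _ μ) * (x : Alg α p) = x * (genH α p - algebraMap ℂ _ μ)
  rw [sub_mul, mul_sub, h, Algebra.commutes]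

/-- The principal ideal `(H - μ)` of the cyclic subalgebra. It is generated by a central element of
that algebra, so the left ideal generated is the two-sided ideal generated. -/
def cyclicIdeal (μ : ℂ) : Ideal (cyclicSubalgebra α p) := Ideal.span {cyclicElt α p μ}

instance cyclicIdeal_isTwoSided (μ : ℂ) : (cyclicIdeal α p μ).IsTwoSided where
  mul_mem_of_left := by
    intro a b ha
    obtain ⟨c, rfl⟩ := Ideal.mem_span_singleton'.mp ha
    rw [mul_assoc, cyclicElt_central, ← mul_assoc]
    exact Ideal.mem_span_singleton'.mpr ⟨_, rfl⟩

theorem cyclicIdeal_isHomogeneous (μ : ℂ) :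
    (cyclicIdeal α p μ).IsHomogeneous
      (subalgebraGrading (grading α p) (cyclicSubalgebra α p)) := by
  intro i a ha
  obtain ⟨c, rfl⟩ := Ideal.mem_span_singleton'.mp ha
  rw [DirectSum.coe_decompose_mul_of_right_mem_zero _ (cyclicElt_mem α p μ)]
  exact Ideal.mem_span_singleton'.mpr ⟨_, rfl⟩

/-- The cyclic subquotient `𝒞_μ = 𝒞 / (H - μ)`. -/
abbrev CyclicSubquotient (μ : ℂ) : Type := cyclicSubalgebra α p ⧸ cyclicIdeal α p μ

/-- The gradation of `𝒞_μ` inherited from `𝒜`. It is indexed by all of `ℤ²`; the component of degree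
`g` vanishes unless `g` commutes with `H`, that is, unless `g₁ α₁ + g₂ α₂ = 0`. -/
abbrev cyclicGrading (μ : ℂ) : (Fin 2 → ℤ) → Submodule ℂ (CyclicSubquotient α p μ) :=
  quotientGrading (subalgebraGrading (grading α p) (cyclicSubalgebra α p)) (cyclicIdeal α p μ)

instance cyclicGradedAlgebra (μ : ℂ) : GradedAlgebra (cyclicGrading α p μ) :=
  quotientGradedAlgebra _ (cyclicIdeal α p μ) (cyclicIdeal_isHomogeneous α p μ)

end Main

section Modules

variable (α : Fin 2 → ℂ) (p : Fin 2 → ℂ[X])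
variable (M : Type*) [AddCommGroup M] [Module ℂ M] [Module (Alg α p) M] [IsScalarTower ℂ (Alg α p) M]

/-- The weight space `M_μ = {v | H v = μ v}`. -/
def weightSpace (μ : ℂ) : Submodule ℂ M :=
  Module.End.eigenspace (Algebra.lsmul ℂ ℂ M (genH α p)) μ

/-- `M` is a weight module: it is the direct sum of its weight spaces. -/
def IsWeightModule : Prop := DirectSum.IsInternal (weightSpace α p M)

/-- The monomial `r X_{i_1}^{ε_1} ⋯ X_{i_k}^{ε_k}` with `r ∈ ℂ[H]`. -/
def monomialElt (r : ℂ[X]) (w : List (Fin 2 × ℤˣ)) : Alg α p :=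
  aeval (genH α p) r * (w.map fun x => genX α p x.1 x.2).prod

/-- The image `X_{i_k}^{-ε_k} ⋯ X_{i_1}^{-ε_1} r` of the monomial `r X_{i_1}^{ε_1} ⋯ X_{i_k}^{ε_k}`
under the anti-automorphism `*` of `𝒜` that fixes `H` and interchanges `X_i^+` and `X_i^-`. -/
def monomialStar (r : ℂ[X]) (w : List (Fin 2 × ℤˣ)) : Alg α p :=
  (w.reverse.map fun x => genX α p x.1 (-x.2)).prod * aeval (genH α p) r

/-- The maximal ideal `𝔪_μ = (H - μ)` of the degree zero component `ℂ[H]` of `𝒜`. -/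
def maxIdealH (μ : ℂ) : Set (Alg α p) :=
  {a | ∃ f : ℂ[X], a = aeval (genH α p) ((X - C μ) * f)}

/-- `M` has no inner breaks: for every weight `μ` of `M` and every monomial `a` with `a M_μ ≠ 0`, the
element `a* a` (which lies in `ℂ[H]`) is not in `(H - μ)`. -/
def NoInnerBreaks : Prop :=
  ∀ μ : ℂ, weightSpace α p M μ ≠ ⊥ → ∀ (r : ℂ[X]) (w : List (Fin 2 × ℤˣ)),
    (∃ v ∈ weightSpace α p M μ, monomialElt α p r w • v ≠ 0) →
      monomialStar α p r w * monomialElt α p r w ∉ maxIdealH α p μ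

end Modules

section Configurations

/-- The face lattice `F = ℤ α₁ + ℤ α₂`. -/
def faceLattice (α : Fin 2 → ℂ) : Set ℂ := {x | ∃ a b : ℤ, x = a * α 0 + b * α 1}

/-- The vertex lattice `V = F + (α₁ + α₂) / 2`. -/
def vertexLattice (α : Fin 2 → ℂ) : Set ℂ := {v | v - (α 0 + α 1) / 2 ∈ faceLattice α}

/-- The set `E_i = F + α_i / 2` of edge midpoints. -/
def edgeSet (α : Fin 2 → ℂ) (i : Fin 2) : Set ℂ := {e | e - α i / 2 ∈ faceLattice α}

/-- A higher spin vertex configuration: a pair of finitely supported labelings `ℒ_i : E_i → ℕ`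
(extended by zero to `ℂ`) satisfying the ice rule at every vertex. -/
structure VertexConfiguration (α : Fin 2 → ℂ) where
  /-- The label of an edge. -/
  label : Fin 2 → ℂ →₀ ℕ
  label_supp : ∀ i e, label i e ≠ 0 → e ∈ edgeSet α i
  ice_rule : ∀ v ∈ vertexLattice α,
    label 0 (v - α 1 / 2) + label 1 (v - α 0 / 2) = label 0 (v + α 1 / 2) + label 1 (v + α 0 / 2)

/-- The polynomials `P_i^ℒ(u) = ∏_{e ∈ E_i} (u - e)^{ℒ_i(e)}`. -/
def VertexConfiguration.P {α : Fin 2 → ℂ} (L : VertexConfiguration α) (i : Fin 2) : ℂ[X] :=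
  (L.label i).prod fun e k => (X - C e) ^ k

end Configurations

end KleinianFiber

end

/-!
The argument works with words in the letters `X_i^ε`. A word `w` satisfies `w* w = N(w)(H)` for an
explicit product `N(w)` of shifted copies of the polynomials `P_i`, and its degree determines by how
much it shifts weights; a word belongs to the centralizer `𝒞` of `H` if that shift, its weight, is
zero.

Two facts about `Ã` carry everything. Letters of opposite sign and different index commute, while a
letter and its inverse multiply to a polynomial in `H`; hence a word of degree zero cancels down to
a polynomial `r(H)`, and since `*` fixes `r(H)` it fixes the word
(`exists_preWord_eq_preEval_and_wordStar`). In `𝒜` nonzero polynomials in `H` can be cancelled. So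
two words `w`, `z` of the same degree in `𝒞` are related by `N(z)(H) w = r(H) z`, where `r(H) = w z*
= z w*` (`exists_evalH_mul_word_eq`), so that `r² = N(z) N(w)`. As the degrees of weight zero are
the multiples of `(m, n)`, every word in `𝒞` is proportional to a power of a fixed word or of its
image under `*`, and `𝒞` is commutative (`cyclicSubalgebra_mul_comm`).

The heart of the proof is that a word `w` in `𝒞` with `N(w)(μ) = 0` is nilpotent modulo `H - μ`
(`exists_word_pow_eq`). Choose a word `s` that leads from `μ` to a weight where `N(w)` does not
vanish, and compare `w^j` with `z = s* w^j s`. The order of `N(z)` at `μ` comes from the two copies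
of `s` alone and does not grow with `j`, whereas `r² = N(z) N(w)^j` forces the order of `r` to grow.
For large `j` the relation `N(z)(H) w^j = r(H) z` can be divided by the power of `H - μ` in `N(z)`,
and a factor `H - μ` remains on the right.

Thus `𝒞_μ` is spanned by words which are nilpotent or invertible according to whether `N(w)`
vanishes at `μ`. A graded component of `𝒞_μ` either consists of nilpotent elements or pairs
nondegenerately with the opposite component, and the nilradical is homogeneous with no nonzero
scalar in it, so the gradation radical is the nilradical (`gradationRadical_eq_setOf_isNilpotent`).
If a simple weight module had an inner break along a word `w` applied to `v ∈ M_μ`, an element `a`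
with `a w v = v` could be chosen with `a w ∈ 𝒞`; but `a w` is a sum of nilpotent classes in `𝒞_μ`,
so it cannot fix `v` (`noInnerBreaks_of_isSimpleModule`).
-/

open Polynomial

noncomputable section

namespace KleinianFiber

theorem sgn_neg (ε : ℤˣ) : sgn (-ε) = -sgn ε := by
  rw [sgn, Units.val_neg, Int.cast_neg]

/-! ### Words in the letters `X_i^ε` -/

/-- The weight `g₁ α₁ + g₂ α₂` of a degree `g`: an element `a` of degree `g` satisfies
`H a = a (H + g₁ α₁ + g₂ α₂)`. -/
def degWeight (α : Fin 2 → ℂ) : (Fin 2 → ℤ) →+ ℂ where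
  toFun g := g 0 * α 0 + g 1 * α 1
  map_zero' := by simp
  map_add' g h := by simp only [Pi.add_apply, Int.cast_add]; ring

theorem degWeight_single (α : Fin 2 → ℂ) (i : Fin 2) (k : ℤ) :
    degWeight α (Pi.single i k) = k * α i := by
  fin_cases i <;> simp [degWeight]

/-- The degree of a word in the letters `X_i^ε`, the letter `X_i^ε` being encoded by `(i, ε)`. -/
def wordDeg (w : List (Fin 2 × ℤˣ)) : Fin 2 → ℤ :=
  (w.map fun x => Pi.single x.1 (x.2 : ℤ)).sum

@[simp] theorem wordDeg_nil : wordDeg [] = 0 := rfl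

@[simp] theorem wordDeg_cons (x : Fin 2 × ℤˣ) (w : List (Fin 2 × ℤˣ)) :
    wordDeg (x :: w) = Pi.single x.1 (x.2 : ℤ) + wordDeg w := by simp [wordDeg]

@[simp] theorem wordDeg_append (u v : List (Fin 2 × ℤˣ)) :
    wordDeg (u ++ v) = wordDeg u + wordDeg v := by simp [wordDeg]

/-- The word read backwards with all signs changed, which represents the image of the word under the
anti-automorphism `*`. -/
def wordStar (w : List (Fin 2 × ℤˣ)) : List (Fin 2 × ℤˣ) :=
  w.reverse.map fun x => (x.1, -x.2)

@[simp] theorem wordStar_nil : wordStar [] = [] := rfl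

@[simp] theorem wordStar_cons (x : Fin 2 × ℤˣ) (w : List (Fin 2 × ℤˣ)) :
    wordStar (x :: w) = wordStar w ++ [(x.1, -x.2)] := by simp [wordStar]

@[simp] theorem wordStar_append (u v : List (Fin 2 × ℤˣ)) :
    wordStar (u ++ v) = wordStar v ++ wordStar u := by simp [wordStar]

@[simp] theorem wordStar_wordStar (w : List (Fin 2 × ℤˣ)) : wordStar (wordStar w) = w := by
  induction w with
  | nil => rfl
  | cons x w ih => simp [ih]

@[simp] theorem wordDeg_wordStar (w : List (Fin 2 × ℤˣ)) : wordDeg (wordStar w) = -wordDeg w := by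
  induction w with
  | nil => simp
  | cons x w ih =>
    simp only [wordStar_cons, wordDeg_append, ih, wordDeg_cons, wordDeg_nil, add_zero, neg_add,
      Units.val_neg, Pi.single_neg]
    abel

theorem wordDeg_nonneg_of_forall_sign {σ : ℤˣ} {w : List (Fin 2 × ℤˣ)} (hw : ∀ x ∈ w, x.2 = σ)
    (i : Fin 2) : 0 ≤ (σ : ℤ) * wordDeg w i := by
  induction w with
  | nil => simp
  | cons x w ih =>
    have h1 := ih fun y hy => hw y (List.mem_cons_of_mem _ hy)
    have h2 : x.2 = σ := hw x List.mem_cons_self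
    have h3 : (σ : ℤ) * (σ : ℤ) = 1 := Int.units_coe_mul_self σ
    simp only [wordDeg_cons, Pi.add_apply, mul_add, h2, Pi.single_apply]
    split_ifs <;> simp <;> omega

theorem wordDeg_pos_of_mem {σ : ℤˣ} {w : List (Fin 2 × ℤˣ)} (hw : ∀ x ∈ w, x.2 = σ)
    {i : Fin 2} (hi : (i, σ) ∈ w) : 0 < (σ : ℤ) * wordDeg w i := by
  have h3 : (σ : ℤ) * (σ : ℤ) = 1 := Int.units_coe_mul_self σ
  obtain ⟨u, v, rfl⟩ := List.append_of_mem hi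
  have hu := wordDeg_nonneg_of_forall_sign (fun x hx => hw x (by simp [hx])) i (w := u)
  have hv := wordDeg_nonneg_of_forall_sign (fun x hx => hw x (by simp [hx])) i (w := v)
  simp only [wordDeg_append, wordDeg_cons, Pi.add_apply, Pi.single_eq_same, mul_add, h3]
  omega

theorem wordDeg_eq_zero_of_notMem {σ : ℤˣ} {w : List (Fin 2 × ℤˣ)} (hw : ∀ x ∈ w, x.2 = σ)
    {i : Fin 2} (hi : (i, σ) ∉ w) : wordDeg w i = 0 := by
  induction w with
  | nil => simp
  | cons x w ih =>
    have h1 := ih (fun y hy => hw y (List.mem_cons_of_mem _ hy))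
      fun h => hi (List.mem_cons_of_mem _ h)
    have h2 : i ≠ x.1 := by
      rintro rfl
      apply hi
      rw [← hw x List.mem_cons_self]
      exact List.mem_cons_self
    simp [h1, h2]

theorem wordDeg_erase {x : Fin 2 × ℤˣ} {w : List (Fin 2 × ℤˣ)} (hx : x ∈ w) :
    wordDeg w = Pi.single x.1 (x.2 : ℤ) + wordDeg (w.erase x) := by
  rw [← wordDeg_cons]
  exact ((List.perm_cons_erase hx).map _).sum_eq

variable (α : Fin 2 → ℂ) (p : Fin 2 → ℂ[X])

/-- The polynomial `N` with `w* w = N(H)`: the product over the letters `X_i^ε` of `w` of the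
polynomials `p_i`, evaluated at the midpoint of the step that the letter makes when `w` is applied
to a vector of weight `u`. -/
def wordNorm : List (Fin 2 × ℤˣ) → ℂ[X]
  | [] => 1
  | x :: w => (p x.1).comp (X + C (sgn x.2 * α x.1 / 2 + degWeight α (wordDeg w))) * wordNorm w

@[simp] theorem wordNorm_nil : wordNorm α p [] = 1 := rfl

theorem wordNorm_cons (x : Fin 2 × ℤˣ) (w : List (Fin 2 × ℤˣ)) :
    wordNorm α p (x :: w)
      = (p x.1).comp (X + C (sgn x.2 * α x.1 / 2 + degWeight α (wordDeg w))) * wordNorm α p w := rfl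

theorem wordNorm_append (u v : List (Fin 2 × ℤˣ)) :
    wordNorm α p (u ++ v)
      = (wordNorm α p u).comp (X + C (degWeight α (wordDeg v))) * wordNorm α p v := by
  induction u with
  | nil => simp
  | cons x u ih =>
    rw [List.cons_append, wordNorm_cons, ih, wordNorm_cons, mul_comp, comp_assoc, ← mul_assoc]
    congr 3
    simp only [wordDeg_append, map_add, add_comp, X_comp, C_comp]
    ring

theorem comp_X_add_C_ne_zero {f : ℂ[X]} (hf : f ≠ 0) (c : ℂ) : f.comp (X + C c) ≠ 0 := by
  intro h0
  apply hf
  have := congrArg (fun q => q.comp (X - C c)) h0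
  simpa [comp_assoc] using this

variable {α p} in
theorem wordNorm_ne_zero (hp : ∀ i, p i ≠ 0) (w : List (Fin 2 × ℤˣ)) : wordNorm α p w ≠ 0 := by
  induction w with
  | nil => simp
  | cons x w ih => exact mul_ne_zero (comp_X_add_C_ne_zero (hp _) _) ih

/-! ### Words in the algebra `Ã` -/

/-- The value of a word in `Ã`. -/
def preWord (w : List (Fin 2 × ℤˣ)) : PreAlg α p :=
  (w.map fun x => preGen α p (.X x.1 x.2)).prod

@[simp] theorem preWord_nil : preWord α p [] = 1 := rfl

@[simp] theorem preWord_cons (x : Fin 2 × ℤˣ) (w : List (Fin 2 × ℤˣ)) :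
    preWord α p (x :: w) = preGen α p (.X x.1 x.2) * preWord α p w := by simp [preWord]

@[simp] theorem preWord_append (u v : List (Fin 2 × ℤˣ)) :
    preWord α p (u ++ v) = preWord α p u * preWord α p v := by simp [preWord]

theorem preEval_mul_preWord (f : ℂ[X]) (w : List (Fin 2 × ℤˣ)) :
    preEval α p f * preWord α p w
      = preWord α p w * preEval α p (f.comp (X + C (degWeight α (wordDeg w)))) := by
  induction w generalizing f with
  | nil => simp
  | cons x w ih =>
    rw [preWord_cons, ← mul_assoc, preEval_shift, mul_assoc, ih, comp_assoc, mul_assoc]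
    congr 4
    simp only [wordDeg_cons, map_add, degWeight_single, add_comp, X_comp, C_comp]
    ring

theorem preWord_mul_preEval (f : ℂ[X]) (w : List (Fin 2 × ℤˣ)) :
    preWord α p w * preEval α p f
      = preEval α p (f.comp (X - C (degWeight α (wordDeg w)))) * preWord α p w := by
  rw [preEval_mul_preWord, comp_assoc]
  simp

theorem preGen_mul_preGen_neg (i : Fin 2) (ε : ℤˣ) :
    preGen α p (.X i ε) * preGen α p (.X i (-ε))
      = preEval α p ((p i).comp (X - C (sgn ε * α i / 2))) := by
  rw [pre_mul, aeval_comp, map_sub, aeval_X, aeval_C]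

theorem preWord_wordStar_mul (w : List (Fin 2 × ℤˣ)) :
    preWord α p (wordStar w) * preWord α p w = preEval α p (wordNorm α p w) := by
  induction w with
  | nil => simp
  | cons x w ih =>
    have h := preGen_mul_preGen_neg α p x.1 (-x.2)
    rw [neg_neg] at h
    rw [wordStar_cons, preWord_append, preWord_cons, preWord_cons, preWord_nil, mul_one, mul_assoc,
      ← mul_assoc (preGen α p _) (preGen α p _), h, preEval_mul_preWord, ← mul_assoc, ih, ← map_mul,
      wordNorm_cons, mul_comm, comp_assoc]
    congr 3
    rw [sgn_neg, neg_mul, neg_div, C_neg, sub_neg_eq_add, add_comp, X_comp, C_comp, map_add]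
    ring

theorem preGen_mul_preWord_of_notMem {i : Fin 2} {σ : ℤˣ} {v : List (Fin 2 × ℤˣ)}
    (hv : ∀ x ∈ v, x.2 = -σ) (hi : (i, -σ) ∉ v) :
    preGen α p (.X i σ) * preWord α p v = preWord α p v * preGen α p (.X i σ) := by
  induction v with
  | nil => simp
  | cons x v ih =>
    obtain ⟨j, τ⟩ := x
    obtain rfl : τ = -σ := hv _ List.mem_cons_self
    have hij : i ≠ j := by rintro rfl; exact hi List.mem_cons_self
    rw [preWord_cons, ← mul_assoc, pre_comm α p i j σ hij, mul_assoc, mul_assoc,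
      ih (fun y hy => hv y (List.mem_cons_of_mem _ hy)) fun h => hi (List.mem_cons_of_mem _ h)]

/-- A letter cancels against the first inverse letter of a word whose letters all have the opposite
sign, since it commutes with the letters in between. -/
theorem preGen_mul_preWord_of_mem {i : Fin 2} {σ : ℤˣ} {v : List (Fin 2 × ℤˣ)}
    (hv : ∀ x ∈ v, x.2 = -σ) (hi : (i, -σ) ∈ v) :
    ∃ f : ℂ[X], preGen α p (.X i σ) * preWord α p v
      = preEval α p f * preWord α p (v.erase (i, -σ)) := by
  induction v with
  | nil => simp at hi
  | cons x v ih =>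
    obtain ⟨j, τ⟩ := x
    obtain rfl : τ = -σ := hv _ List.mem_cons_self
    by_cases hij : i = j
    · subst hij
      exact ⟨_, by rw [List.erase_cons_head, preWord_cons, ← mul_assoc, preGen_mul_preGen_neg]⟩
    · have hne : (j, -σ) ≠ (i, -σ) := fun h => hij (congrArg Prod.fst h).symm
      have hmem : (i, -σ) ∈ v := (List.mem_cons.mp hi).resolve_left fun h => hne h.symm
      obtain ⟨f, hf⟩ := ih (fun y hy => hv y (List.mem_cons_of_mem _ hy)) hmem
      refine ⟨f.comp (X - C (degWeight α (wordDeg [(j, -σ)]))), ?_⟩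
      have h := preWord_mul_preEval α p f [(j, -σ)]
      rw [preWord_cons, preWord_nil, mul_one] at h
      rw [List.erase_cons_tail (by simpa using hne), preWord_cons, preWord_cons, ← mul_assoc,
        pre_comm α p i j σ hij, mul_assoc, hf, ← mul_assoc, h, mul_assoc]

/-- Every word is a polynomial in `H` times a word in which the letters `X_i^+` precede the letters
`X_i^-`. -/
theorem exists_preWord_eq_sorted (w : List (Fin 2 × ℤˣ)) :
    ∃ (f : ℂ[X]) (u v : List (Fin 2 × ℤˣ)), (∀ x ∈ u, x.2 = 1) ∧ (∀ x ∈ v, x.2 = -1) ∧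
      wordDeg u + wordDeg v = wordDeg w ∧
      preWord α p w = preEval α p f * (preWord α p u * preWord α p v) := by
  induction w with
  | nil => exact ⟨1, [], [], by simp, by simp, by simp, by simp⟩
  | cons x w ih =>
    obtain ⟨f, u, v, hu, hv, hd, hw⟩ := ih
    have hx := preWord_mul_preEval α p f [x]
    rw [preWord_cons, preWord_nil, mul_one] at hx
    have key : preWord α p (x :: w) = preEval α p (f.comp (X - C (degWeight α (wordDeg [x]))))
        * (preGen α p (.X x.1 x.2) * preWord α p u * preWord α p v) := by
      rw [preWord_cons, hw, ← mul_assoc, hx]; simp only [mul_assoc]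
    obtain ⟨i, σ⟩ := x
    rcases Int.units_eq_one_or σ with rfl | rfl
    · refine ⟨_, (i, 1) :: u, v, ?_, hv, ?_, by rw [key, preWord_cons]⟩
      · intro y hy
        rcases List.mem_cons.mp hy with rfl | hy
        · rfl
        · exact hu y hy
      · rw [wordDeg_cons, wordDeg_cons, add_assoc, hd]
    · have hu' : ∀ y ∈ u, y.2 = -(-1 : ℤˣ) := by simpa using hu
      by_cases hi : (i, -(-1 : ℤˣ)) ∈ u
      · obtain ⟨g, hg⟩ := preGen_mul_preWord_of_mem α p hu' hi
        refine ⟨f.comp (X - C (degWeight α (wordDeg [(i, -1)]))) * g, u.erase (i, -(-1)), v,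
          fun y hy => hu y (List.mem_of_mem_erase hy), hv, ?_, ?_⟩
        · rw [wordDeg_cons, ← hd, wordDeg_erase hi]
          simp only [Units.val_neg, Pi.single_neg, Units.val_one]
          abel
        · rw [key, hg, map_mul]; simp only [mul_assoc]
      · refine ⟨f.comp (X - C (degWeight α (wordDeg [(i, -1)]))), u, (i, -1) :: v, hu, ?_, ?_, ?_⟩
        · intro y hy
          rcases List.mem_cons.mp hy with rfl | hy
          · rfl
          · exact hv y hy
        · rw [wordDeg_cons, wordDeg_cons, ← hd]; abel
        · rw [key, preGen_mul_preWord_of_notMem α p hu' hi, preWord_cons]; simp only [mul_assoc]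

theorem exists_preWord_mul_preWord_eq_preEval (u v : List (Fin 2 × ℤˣ)) (hu : ∀ x ∈ u, x.2 = 1)
    (hv : ∀ x ∈ v, x.2 = -1) (hd : wordDeg u + wordDeg v = 0) :
    ∃ f : ℂ[X], preWord α p u * preWord α p v = preEval α p f := by
  induction u using List.reverseRecOn generalizing v with
  | nil =>
    cases v with
    | nil => exact ⟨1, by simp⟩
    | cons y v =>
      exfalso
      have hy : y.2 = -1 := hv y List.mem_cons_self
      have h1 := wordDeg_pos_of_mem hv (i := y.1) (by rw [← hy]; exact List.mem_cons_self)
      have h2 := congrFun hd y.1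
      simp only [wordDeg_nil, zero_add, Pi.zero_apply] at h2
      simp [h2] at h1
  | append_singleton u x ih =>
    obtain ⟨i, σ⟩ := x
    obtain rfl : σ = 1 := hu (i, σ) (by simp)
    -- the degree condition forces the inverse of the last positive letter to occur in `v`
    have hi : (i, -(1 : ℤˣ)) ∈ v := by
      by_contra h
      have h1 := wordDeg_eq_zero_of_notMem hv h
      have h2 := wordDeg_pos_of_mem hu (i := i) (by simp)
      have h3 := congrFun hd i
      rw [Pi.add_apply, h1, add_zero] at h3
      simp [h3] at h2
    obtain ⟨f, hf⟩ := preGen_mul_preWord_of_mem α p hv hi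
    obtain ⟨g, hg⟩ := ih (v.erase (i, -1)) (fun y hy => hu y (by simp [hy]))
      (fun y hy => hv y (List.mem_of_mem_erase hy)) (by
        rw [← hd, wordDeg_erase hi, wordDeg_append, wordDeg_cons, wordDeg_nil]
        simp only [Units.val_neg, Pi.single_neg, Units.val_one]
        abel)
    refine ⟨f.comp (X - C (degWeight α (wordDeg u))) * g, ?_⟩
    rw [preWord_append, preWord_cons, preWord_nil, mul_one, mul_assoc, hf, ← mul_assoc,
      preWord_mul_preEval, mul_assoc, hg, map_mul]

theorem exists_preWord_eq_preEval (w : List (Fin 2 × ℤˣ)) (hw : wordDeg w = 0) :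
    ∃ f : ℂ[X], preWord α p w = preEval α p f := by
  obtain ⟨f, u, v, hu, hv, hd, h⟩ := exists_preWord_eq_sorted α p w
  obtain ⟨g, hg⟩ := exists_preWord_mul_preWord_eq_preEval α p u v hu hv (hd.trans hw)
  exact ⟨f * g, by rw [h, hg, map_mul]⟩

theorem sub_swap_eq_smul {A : Type*} [Ring A] [Algebra ℂ A] {a b c : A} {t : ℂ}
    (h : a - b = -t • c) : b - a = t • c := by
  rw [← neg_sub, h, neg_smul, neg_neg]

theorem op_aeval {A : Type*} [Ring A] [Algebra ℂ A] (a : A) (f : ℂ[X]) :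
    MulOpposite.op (aeval a f) = aeval (MulOpposite.op a) f := by
  induction f using Polynomial.induction_on' with
  | add f g hf hg => rw [map_add, map_add, ← hf, ← hg, MulOpposite.op_add]
  | monomial k c =>
    rw [aeval_monomial, aeval_monomial, ← MulOpposite.op_pow, MulOpposite.algebraMap_apply,
      ← MulOpposite.op_mul, Algebra.commutes]

/-- The anti-automorphism `*` of `Ã` that fixes `H` and interchanges `X_i^+` and `X_i^-`, as a
homomorphism to the opposite algebra. -/
def preStar : PreAlg α p →ₐ[ℂ] (PreAlg α p)ᵐᵒᵖ :=
  RingQuot.liftAlgHom ℂ (s := Rel α p)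
    ⟨FreeAlgebra.lift ℂ fun
      | .H => MulOpposite.op (preGen α p .H)
      | .X i ε => MulOpposite.op (preGen α p (.X i (-ε))), by
      intro x y h
      induction h with
      | weight i ε =>
        simp only [map_sub, map_mul, FreeAlgebra.lift_ι_apply, map_smul, ← MulOpposite.op_mul,
          ← MulOpposite.op_sub, ← MulOpposite.op_smul]
        congr 1
        have h := pre_weight α p i (-ε)
        rw [sgn_neg, neg_mul] at h
        exact sub_swap_eq_smul h
      | mul i ε =>
        rw [map_mul, ← Polynomial.aeval_algHom_apply, map_sub, AlgHom.commutes]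
        simp only [FreeAlgebra.lift_ι_apply, ← MulOpposite.op_mul, neg_neg]
        rw [pre_mul, op_aeval, MulOpposite.op_sub, MulOpposite.algebraMap_apply]
      | comm i j ε hij =>
        simp only [map_mul, FreeAlgebra.lift_ι_apply, ← MulOpposite.op_mul, neg_neg]
        rw [pre_comm α p j i ε hij.symm]⟩

theorem preStar_preGen_H : preStar α p (preGen α p .H) = MulOpposite.op (preGen α p .H) :=
  (RingQuot.liftAlgHom_mkAlgHom_apply ℂ _ _ _).trans (FreeAlgebra.lift_ι_apply _ _)

theorem preStar_preGen_X (i : Fin 2) (ε : ℤˣ) :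
    preStar α p (preGen α p (.X i ε)) = MulOpposite.op (preGen α p (.X i (-ε))) :=
  (RingQuot.liftAlgHom_mkAlgHom_apply ℂ _ _ _).trans (FreeAlgebra.lift_ι_apply _ _)

theorem preStar_preWord (w : List (Fin 2 × ℤˣ)) :
    preStar α p (preWord α p w) = MulOpposite.op (preWord α p (wordStar w)) := by
  induction w with
  | nil => simp
  | cons x w ih => simp [preStar_preGen_X, ih]

theorem preStar_preEval (f : ℂ[X]) :
    preStar α p (preEval α p f) = MulOpposite.op (preEval α p f) := by
  rw [← aeval_algHom_apply, preStar_preGen_H, op_aeval]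

/-- A word of degree zero is a polynomial in `H`, hence it is fixed by `*`. -/
theorem exists_preWord_eq_preEval_and_wordStar (w : List (Fin 2 × ℤˣ)) (hw : wordDeg w = 0) :
    ∃ f : ℂ[X], preWord α p w = preEval α p f ∧ preWord α p (wordStar w) = preEval α p f := by
  obtain ⟨f, hf⟩ := exists_preWord_eq_preEval α p w hw
  refine ⟨f, hf, MulOpposite.op_injective ?_⟩
  rw [← preStar_preWord, hf, preStar_preEval]

theorem exists_eq_preEval_mul_preWord (w : List Gen) :
    ∃ (f : ℂ[X]) (v : List (Fin 2 × ℤˣ)), wordDeg v = (w.map genDeg).sum ∧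
      (w.map (preGen α p)).prod = preEval α p f * preWord α p v := by
  induction w with
  | nil => exact ⟨1, [], by simp, by simp⟩
  | cons g w ih =>
    obtain ⟨f, v, hd, hv⟩ := ih
    cases g with
    | H => exact ⟨X * f, v, by simp [genDeg, hd], by simp [hv, mul_assoc]⟩
    | X i ε =>
      refine ⟨f.comp (X - C (degWeight α (wordDeg [(i, ε)]))), (i, ε) :: v, ?_, ?_⟩
      · simp [genDeg, hd]
      · have h := preWord_mul_preEval α p f [(i, ε)]
        rw [preWord_cons, preWord_nil, mul_one] at h
        rw [List.map_cons, List.prod_cons, hv, ← mul_assoc, h, mul_assoc, preWord_cons]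

/-! ### Words in the algebra `𝒜` -/

/-- The homomorphism `f ↦ f(H)` from `ℂ[u]` to `𝒜`. -/
abbrev evalH : ℂ[X] →ₐ[ℂ] Alg α p := aeval (genH α p)

/-- The value of a word in `𝒜`. -/
def word (w : List (Fin 2 × ℤˣ)) : Alg α p := (w.map fun x => genX α p x.1 x.2).prod

@[simp] theorem word_nil : word α p [] = 1 := rfl

@[simp] theorem word_append (u v : List (Fin 2 × ℤˣ)) :
    word α p (u ++ v) = word α p u * word α p v := by simp [word]

theorem mk_preEval (f : ℂ[X]) :
    Ideal.Quotient.mkₐ ℂ (torsionIdeal α p) (preEval α p f) = evalH α p f := by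
  rw [← aeval_algHom_apply]; rfl

theorem mk_preWord (w : List (Fin 2 × ℤˣ)) :
    Ideal.Quotient.mkₐ ℂ (torsionIdeal α p) (preWord α p w) = word α p w := by
  rw [preWord, map_list_prod, List.map_map]; rfl

theorem evalH_mul_word (f : ℂ[X]) (w : List (Fin 2 × ℤˣ)) :
    evalH α p f * word α p w
      = word α p w * evalH α p (f.comp (X + C (degWeight α (wordDeg w)))) := by
  simp only [← mk_preEval, ← mk_preWord, ← map_mul]
  rw [preEval_mul_preWord]

theorem word_wordStar_mul (w : List (Fin 2 × ℤˣ)) :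
    word α p (wordStar w) * word α p w = evalH α p (wordNorm α p w) := by
  simp only [← mk_preEval, ← mk_preWord, ← map_mul]
  rw [preWord_wordStar_mul]

theorem word_mul_wordStar (w : List (Fin 2 × ℤˣ)) :
    word α p w * word α p (wordStar w) = evalH α p (wordNorm α p (wordStar w)) := by
  simpa using word_wordStar_mul α p (wordStar w)

theorem exists_word_eq_evalH_and_wordStar (w : List (Fin 2 × ℤˣ)) (hw : wordDeg w = 0) :
    ∃ f : ℂ[X], word α p w = evalH α p f ∧ word α p (wordStar w) = evalH α p f := by
  obtain ⟨f, h1, h2⟩ := exists_preWord_eq_preEval_and_wordStar α p w hw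
  exact ⟨f, by rw [← mk_preEval, ← mk_preWord, h1], by rw [← mk_preEval, ← mk_preWord, h2]⟩

variable {α p} in
theorem eq_zero_of_evalH_mul_eq_zero {f : ℂ[X]} (hf : f ≠ 0) {a : Alg α p}
    (h : evalH α p f * a = 0) : a = 0 := by
  obtain ⟨b, rfl⟩ := Ideal.Quotient.mkₐ_surjective ℂ (torsionIdeal α p) a
  rw [← mk_preEval, ← map_mul] at h
  obtain ⟨g, hg, hb⟩ : preEval α p f * b ∈ torsionIdeal α p := Ideal.Quotient.eq_zero_iff_mem.mp h
  refine Ideal.Quotient.eq_zero_iff_mem.mpr ⟨g * f, mul_ne_zero hg hf, ?_⟩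
  rw [map_mul, mul_assoc, hb]

variable {α p} in
theorem eq_of_evalH_mul_eq {f : ℂ[X]} (hf : f ≠ 0) {a b : Alg α p}
    (h : evalH α p f * a = evalH α p f * b) : a = b := by
  rw [← sub_eq_zero]
  apply eq_zero_of_evalH_mul_eq_zero hf
  rw [mul_sub, h, sub_self]

theorem evalH_injective [Nontrivial (Alg α p)] : Function.Injective (evalH α p) := by
  rw [injective_iff_map_eq_zero]
  intro f hf
  by_contra h
  exact one_ne_zero (eq_zero_of_evalH_mul_eq_zero h (a := (1 : Alg α p)) (by rw [hf, zero_mul]))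

theorem mem_span_of_mem_grading {g : Fin 2 → ℤ} {a : Alg α p} (ha : a ∈ grading α p g) :
    a ∈ Submodule.span ℂ
      {b | ∃ (f : ℂ[X]) (w : List (Fin 2 × ℤˣ)), wordDeg w = g ∧ evalH α p f * word α p w = b} := by
  obtain ⟨b, hb, rfl⟩ := ha
  have h := Submodule.mem_map_of_mem (f := (Ideal.Quotient.mkₐ ℂ (torsionIdeal α p)).toLinearMap) hb
  rw [preGrading, Submodule.map_span] at h
  refine Submodule.span_mono ?_ h
  rintro _ ⟨_, ⟨w, hw, rfl⟩, rfl⟩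
  obtain ⟨f, v, hd, hv⟩ := exists_eq_preEval_mul_preWord α p w
  refine ⟨f, v, hd.trans hw, ?_⟩
  rw [hv, AlgHom.toLinearMap_apply, map_mul, mk_preEval, mk_preWord]

theorem word_mem_grading (w : List (Fin 2 × ℤˣ)) : word α p w ∈ grading α p (wordDeg w) := by
  rw [← mk_preWord]
  refine Submodule.mem_map_of_mem (Submodule.subset_span
    ⟨w.map fun x => Gen.X x.1 x.2, ?_, ?_⟩)
  · rw [List.map_map]; rfl
  · rw [List.map_map]; rfl

/-! ### The centralizer of `H` -/

theorem evalH_mem (f : ℂ[X]) : evalH α p f ∈ cyclicSubalgebra α p := by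
  rw [Subalgebra.mem_centralizer_iff]
  rintro _ rfl
  have h := congrArg (evalH α p) (mul_comm X f)
  simpa using h

variable {α} in
theorem evalH_commute_word {w : List (Fin 2 × ℤˣ)} (hw : degWeight α (wordDeg w) = 0) (f : ℂ[X]) :
    Commute (evalH α p f) (word α p w) := by
  have h := evalH_mul_word α p f w
  rwa [hw, C_0, add_zero, comp_X] at h

variable {α} in
theorem word_mem {w : List (Fin 2 × ℤˣ)} (hw : degWeight α (wordDeg w) = 0) :
    word α p w ∈ cyclicSubalgebra α p := by
  rw [Subalgebra.mem_centralizer_iff]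
  rintro _ rfl
  have h := evalH_commute_word p hw X
  rwa [aeval_X] at h

variable {α p} in
theorem genH_mul_of_mem_grading {g : Fin 2 → ℤ} {a : Alg α p} (ha : a ∈ grading α p g) :
    genH α p * a = a * (genH α p + algebraMap ℂ _ (degWeight α g)) := by
  replace ha := mem_span_of_mem_grading α p ha
  induction ha using Submodule.span_induction with
  | mem x hx =>
    obtain ⟨f, w, rfl, rfl⟩ := hx
    have hX := evalH_mul_word α p X w
    rw [aeval_X, X_comp, map_add, aeval_X, aeval_C] at hX
    have hc := (Subalgebra.mem_centralizer_iff ℂ).mp (evalH_mem α p f) _ rfl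
    rw [← mul_assoc, hc, mul_assoc, hX, mul_assoc]
  | zero => simp
  | add x y _ _ hx hy => rw [mul_add, hx, hy, add_mul]
  | smul c x _ hx => rw [mul_smul_comm, hx, smul_mul_assoc]

variable {α p} in
/-- An element of degree `g` which commutes with `H` vanishes unless `g` has weight zero. -/
theorem eq_zero_of_mem_grading_of_mem {g : Fin 2 → ℤ} {a : Alg α p} (ha : a ∈ grading α p g)
    (hac : a ∈ cyclicSubalgebra α p) (hg : degWeight α g ≠ 0) : a = 0 := by
  have h1 := genH_mul_of_mem_grading ha
  rw [(Subalgebra.mem_centralizer_iff ℂ).mp hac _ rfl, mul_add, left_eq_add,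
    ← Algebra.commutes, ← Algebra.smul_def] at h1
  exact (smul_eq_zero.mp h1).resolve_left hg

variable {α p} in
theorem mem_span_of_mem_cyclicSubalgebra {a : Alg α p} (ha : a ∈ cyclicSubalgebra α p) :
    a ∈ Submodule.span ℂ {b | ∃ (f : ℂ[X]) (w : List (Fin 2 × ℤˣ)),
      degWeight α (wordDeg w) = 0 ∧ evalH α p f * word α p w = b} := by
  classical
  rw [← DirectSum.sum_support_decompose (grading α p) a]
  refine Submodule.sum_mem _ fun g _ => ?_
  have hm : ((DirectSum.decompose (grading α p) a g : grading α p g) : Alg α p) ∈ grading α p g :=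
    SetLike.coe_mem _
  by_cases hg : degWeight α g = 0
  · refine Submodule.span_mono ?_ (mem_span_of_mem_grading α p hm)
    rintro _ ⟨f, w, rfl, rfl⟩
    exact ⟨f, w, hg, rfl⟩
  · rw [eq_zero_of_mem_grading_of_mem hm (cyclicSubalgebra_proj_mem α p a ha g) hg]
    exact Submodule.zero_mem _

variable {α} in
/-- Over `ℂ[H]`, words of the same degree are proportional. Because a word of degree zero is fixed
by `*`, the same polynomial occurs when the two words are interchanged. -/
theorem exists_evalH_mul_word_eq {w z : List (Fin 2 × ℤˣ)} (hw : degWeight α (wordDeg w) = 0)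
    (h : wordDeg w = wordDeg z) :
    ∃ r : ℂ[X], evalH α p (wordNorm α p z) * word α p w = evalH α p r * word α p z ∧
      word α p w * word α p (wordStar z) = evalH α p r ∧
      word α p z * word α p (wordStar w) = evalH α p r := by
  obtain ⟨r, h1, h2⟩ := exists_word_eq_evalH_and_wordStar α p (w ++ wordStar z) (by simp [h])
  rw [word_append] at h1
  rw [wordStar_append, wordStar_wordStar, word_append] at h2
  exact ⟨r, by rw [(evalH_commute_word p hw _).eq, ← word_wordStar_mul, ← mul_assoc, h1], h1, h2⟩

variable {α p} in
theorem commute_word_wordStar (hp : ∀ i, p i ≠ 0) {w : List (Fin 2 × ℤˣ)}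
    (hw : degWeight α (wordDeg w) = 0) : Commute (word α p w) (word α p (wordStar w)) := by
  have h1 := word_wordStar_mul α p w
  have h2 := word_mul_wordStar α p w
  have h3 : evalH α p (wordNorm α p (wordStar w) - wordNorm α p w) * word α p w = 0 := by
    rw [map_sub, sub_mul, ← h2, mul_assoc, h1, (evalH_commute_word p hw _).eq, sub_self]
  have h4 : evalH α p (wordNorm α p (wordStar w)) *
      evalH α p (wordNorm α p (wordStar w) - wordNorm α p w) = 0 := by
    rw [← map_mul, mul_comm, map_mul, ← h2, ← mul_assoc, h3, zero_mul]
  have h5 := eq_zero_of_evalH_mul_eq_zero (wordNorm_ne_zero hp _) h4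
  rw [map_sub, sub_eq_zero] at h5
  exact h2.trans (h5.trans h1.symm)

/-- The `j`-fold repetition of a word. -/
def wordPow (w : List (Fin 2 × ℤˣ)) (j : ℕ) : List (Fin 2 × ℤˣ) := (List.replicate j w).flatten

theorem wordPow_succ (w : List (Fin 2 × ℤˣ)) (j : ℕ) : wordPow w (j + 1) = w ++ wordPow w j := by
  simp [wordPow, List.replicate_succ]

@[simp] theorem wordDeg_wordPow (w : List (Fin 2 × ℤˣ)) (j : ℕ) :
    wordDeg (wordPow w j) = j • wordDeg w := by
  induction j with
  | zero => simp [wordPow]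
  | succ j ih => rw [wordPow_succ, wordDeg_append, ih, succ_nsmul']

@[simp] theorem word_wordPow (w : List (Fin 2 × ℤˣ)) (j : ℕ) :
    word α p (wordPow w j) = word α p w ^ j := by
  induction j with
  | zero => simp [wordPow]
  | succ j ih => rw [wordPow_succ, word_append, ih, pow_succ']

variable {α} in
theorem wordNorm_wordPow {w : List (Fin 2 × ℤˣ)} (hw : degWeight α (wordDeg w) = 0) (j : ℕ) :
    wordNorm α p (wordPow w j) = wordNorm α p w ^ j := by
  induction j with
  | zero => simp [wordPow]
  | succ j ih =>
    rw [wordPow_succ, wordNorm_append, ih, wordDeg_wordPow, map_nsmul, hw, smul_zero, C_0, add_zero,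
      comp_X, pow_succ']

/-- The degrees of weight zero form the cyclic group generated by `(m, n)`. -/
theorem exists_eq_mul_of_degWeight_eq_zero {m n : ℕ} (hmn : Nat.Coprime m n) {α : Fin 2 → ℂ}
    (hα : α ≠ 0) (hmnα : (m : ℂ) * α 0 + (n : ℂ) * α 1 = 0) {g : Fin 2 → ℤ}
    (hg : degWeight α g = 0) : ∃ k : ℤ, g 0 = k * m ∧ g 1 = k * n := by
  replace hg : (g 0 : ℂ) * α 0 + (g 1 : ℂ) * α 1 = 0 := hg
  have hdet : g 0 * n = g 1 * m := by
    have h0 : ((g 0 : ℂ) * n - g 1 * m) * α 0 = 0 := by linear_combination (n : ℂ) * hg - g 1 * hmnα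
    have h1 : ((g 0 : ℂ) * n - g 1 * m) * α 1 = 0 := by linear_combination g 0 * hmnα - (m : ℂ) * hg
    have h2 : ((g 0 : ℂ) * n - g 1 * m) = 0 := by
      by_contra hne
      apply hα
      ext i
      fin_cases i
      · exact (mul_eq_zero.mp h0).resolve_left hne
      · exact (mul_eq_zero.mp h1).resolve_left hne
    exact_mod_cast sub_eq_zero.mp h2
  obtain ⟨a, b, hab⟩ := Nat.isCoprime_iff_coprime.mpr hmn
  exact ⟨a * g 0 + b * g 1, by linear_combination (-g 0) * hab + b * hdet,
    by linear_combination (-g 1) * hab - a * hdet⟩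

/-- Words of weight zero commute: they are proportional over `ℂ[H]` to the powers of one word of
degree `(m, n)` and of its image under `*`. -/
theorem commute_word_word {m n : ℕ} (hmn : Nat.Coprime m n) {α : Fin 2 → ℂ}
    (hα : α ≠ 0) (hmnα : (m : ℂ) * α 0 + (n : ℂ) * α 1 = 0) {p : Fin 2 → ℂ[X]} (hp : ∀ i, p i ≠ 0)
    {v w : List (Fin 2 × ℤˣ)} (hv : degWeight α (wordDeg v) = 0)
    (hw : degWeight α (wordDeg w) = 0) : Commute (word α p v) (word α p w) := by
  let c : List (Fin 2 × ℤˣ) := wordPow [(0, 1)] m ++ wordPow [(1, 1)] n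
  have hc : wordDeg c = ![(m : ℤ), n] := by
    ext i; fin_cases i <;> simp [c]
  have hcw : degWeight α (wordDeg c) = 0 := by
    rw [hc]; simpa [degWeight] using hmnα
  have hcc := commute_word_wordStar hp hcw
  have key : ∀ u, degWeight α (wordDeg u) = 0 → ∃ (q r : ℂ[X]) (z : List (Fin 2 × ℤˣ)), q ≠ 0 ∧
      degWeight α (wordDeg z) = 0 ∧ evalH α p q * word α p u = evalH α p r * word α p z ∧
      ((∃ j, z = wordPow c j) ∨ ∃ j, z = wordPow (wordStar c) j) := by
    intro u hu
    obtain ⟨k, hk0, hk1⟩ := exists_eq_mul_of_degWeight_eq_zero hmn hα hmnα hu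
    have hd : wordDeg u = k • wordDeg c := by
      rw [hc]; ext i; fin_cases i <;> simp [hk0, hk1]
    obtain ⟨j, rfl | rfl⟩ := k.eq_nat_or_neg
    · have hz : wordDeg u = wordDeg (wordPow c j) := by rw [hd, wordDeg_wordPow, natCast_zsmul]
      obtain ⟨r, hr, -⟩ := exists_evalH_mul_word_eq p hu hz
      exact ⟨_, r, _, wordNorm_ne_zero hp _, hz ▸ hu, hr, Or.inl ⟨j, rfl⟩⟩
    · have hz : wordDeg u = wordDeg (wordPow (wordStar c) j) := by
        rw [hd, wordDeg_wordPow, wordDeg_wordStar, neg_smul, natCast_zsmul, smul_neg]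
      obtain ⟨r, hr, -⟩ := exists_evalH_mul_word_eq p hu hz
      exact ⟨_, r, _, wordNorm_ne_zero hp _, hz ▸ hu, hr, Or.inr ⟨j, rfl⟩⟩
  obtain ⟨q, r, y, hq, hy, hvy, hy'⟩ := key v hv
  obtain ⟨q', r', z, hq', hz, hwz, hz'⟩ := key w hw
  have hyz : Commute (word α p y) (word α p z) := by
    rcases hy' with ⟨j, rfl⟩ | ⟨j, rfl⟩ <;> rcases hz' with ⟨k, rfl⟩ | ⟨k, rfl⟩ <;>
      simp only [word_wordPow]
    · exact (Commute.refl _).pow_pow _ _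
    · exact hcc.pow_pow _ _
    · exact hcc.symm.pow_pow _ _
    · exact (Commute.refl _).pow_pow _ _
  have hcomm : ∀ f g : ℂ[X], Commute (evalH α p f) (evalH α p g) := fun f g =>
    (Commute.all f g).map (evalH α p)
  have h1 : Commute (evalH α p q * word α p v) (evalH α p q' * word α p w) := by
    rw [hvy, hwz]
    exact ((hcomm _ _).mul_right (evalH_commute_word p hz _)).mul_left
      ((evalH_commute_word p hy _).symm.mul_right hyz)
  refine eq_of_evalH_mul_eq (mul_ne_zero hq hq') ?_
  have h2 : ∀ (f g : ℂ[X]) (u t : List (Fin 2 × ℤˣ)), degWeight α (wordDeg u) = 0 →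
      evalH α p (f * g) * (word α p u * word α p t)
        = evalH α p f * word α p u * (evalH α p g * word α p t) := by
    intro f g u t hu
    rw [map_mul, mul_assoc, ← mul_assoc (evalH α p g), (evalH_commute_word p hu g).eq]
    simp only [mul_assoc]
  rw [h2 _ _ _ _ hv, h1.eq, mul_comm q q', h2 _ _ _ _ hw]

theorem cyclicSubalgebra_mul_comm {m n : ℕ} (hmn : Nat.Coprime m n) {α : Fin 2 → ℂ}
    (hα : α ≠ 0) (hmnα : (m : ℂ) * α 0 + (n : ℂ) * α 1 = 0) {p : Fin 2 → ℂ[X]} (hp : ∀ i, p i ≠ 0)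
    (x y : cyclicSubalgebra α p) : x * y = y * x := by
  have key : ∀ a ∈ cyclicSubalgebra α p, ∀ b ∈ cyclicSubalgebra α p, Commute a b := by
    intro a ha b hb
    replace ha := mem_span_of_mem_cyclicSubalgebra ha
    replace hb := mem_span_of_mem_cyclicSubalgebra hb
    induction ha, hb using Submodule.span_induction₂ with
    | mem_mem a b ha hb =>
      obtain ⟨f, v, hv, rfl⟩ := ha
      obtain ⟨g, w, hw, rfl⟩ := hb
      exact (((Commute.all f g).map (evalH α p)).mul_right (evalH_commute_word p hw _)).mul_left
        ((evalH_commute_word p hv _).symm.mul_right (commute_word_word hmn hα hmnα hp hv hw))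
    | zero_left => exact Commute.zero_left _
    | zero_right => exact Commute.zero_right _
    | add_left _ _ _ _ _ _ h1 h2 => exact h1.add_left h2
    | add_right _ _ _ _ _ _ h1 h2 => exact h1.add_right h2
    | smul_left c _ _ _ _ h => exact h.smul_left c
    | smul_right c _ _ _ _ h => exact h.smul_right c
  exact Subtype.ext (key x x.2 y y.2)

/-! ### Nilpotent words -/

variable {α p} in
/-- If `f(H) x = f'(H) z` in the centralizer of `H` and `f'` vanishes at `μ` to higher order than
`f`, then `x` is divisible by `H - μ`. -/
theorem exists_eq_evalH_mul {f f' : ℂ[X]} {μ : ℂ} (hf : f ≠ 0)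
    (hff' : (X - C μ) ^ (f.rootMultiplicity μ + 1) ∣ f') {x z : Alg α p}
    (hx : x ∈ cyclicSubalgebra α p) (hz : z ∈ cyclicSubalgebra α p)
    (h : evalH α p f * x = evalH α p f' * z) :
    ∃ c ∈ cyclicSubalgebra α p, x = evalH α p (X - C μ) * c := by
  obtain ⟨f₁, hf₁, hroot⟩ := exists_eq_pow_rootMultiplicity_mul_and_not_dvd f hf μ
  obtain ⟨f₂, hf₂⟩ := hff'
  have h1 : evalH α p f₁ * x = evalH α p ((X - C μ) * f₂) * z := by
    refine eq_of_evalH_mul_eq (pow_ne_zero (f.rootMultiplicity μ) (X_sub_C_ne_zero μ)) ?_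
    rw [← mul_assoc, ← map_mul, ← hf₁, h, ← mul_assoc, ← map_mul, ← mul_assoc, ← pow_succ, ← hf₂]
  obtain ⟨a, b, hab⟩ : IsCoprime (X - C μ) f₁ :=
    ((irreducible_X_sub_C μ).coprime_iff_not_dvd).mpr hroot
  refine ⟨evalH α p a * x + evalH α p (b * f₂) * z,
    add_mem (mul_mem (evalH_mem α p a) hx) (mul_mem (evalH_mem α p _) hz), ?_⟩
  calc x = evalH α p (a * (X - C μ) + b * f₁) * x := by rw [hab, map_one, one_mul]
    _ = evalH α p ((X - C μ) * a) * x + evalH α p b * (evalH α p f₁ * x) := by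
      rw [map_add, add_mul, mul_comm a, map_mul (evalH α p) b, mul_assoc (evalH α p b)]
    _ = evalH α p (X - C μ) * (evalH α p a * x + evalH α p (b * f₂) * z) := by
      rw [h1, mul_add, ← mul_assoc, ← mul_assoc, ← mul_assoc, ← map_mul, ← map_mul, ← map_mul,
        mul_left_comm]

/-- Any nonzero polynomial is nonzero at some point of the form `μ + k α_i`, `k ∈ ℕ`; these points
are the weights reached from `μ` by the powers of a letter. -/
theorem exists_eval_add_degWeight_ne_zero {α : Fin 2 → ℂ} (hα : α ≠ 0) {f : ℂ[X]} (hf : f ≠ 0)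
    (μ : ℂ) : ∃ s : List (Fin 2 × ℤˣ), f.eval (μ + degWeight α (wordDeg s)) ≠ 0 := by
  obtain ⟨i, hi⟩ := Function.ne_iff.mp hα
  have hinj : Function.Injective fun k : ℕ => μ + degWeight α (wordDeg (wordPow [(i, 1)] k)) := by
    intro k l h
    have hk (k : ℕ) : degWeight α (wordDeg (wordPow [(i, 1)] k)) = k * α i := by
      rw [wordDeg_wordPow, map_nsmul, wordDeg_cons, wordDeg_nil, add_zero, degWeight_single,
        nsmul_eq_mul, Units.val_one, Int.cast_one, one_mul]
    simp only [hk, add_right_inj] at h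
    exact_mod_cast mul_right_cancel₀ hi h
  by_contra! hcon
  refine hf (Polynomial.eq_zero_of_infinite_isRoot f
    ((Set.infinite_range_of_injective hinj).mono ?_))
  rintro _ ⟨k, rfl⟩
  exact hcon _

/-- The order of vanishing at `μ` of `N(s* w^j s)` does not depend on `j` if `N(w)` is nonzero at
the weight to which `s` leads from `μ`. -/
theorem rootMultiplicity_wordNorm_conj {α : Fin 2 → ℂ} {p : Fin 2 → ℂ[X]} (hp : ∀ i, p i ≠ 0)
    {w s : List (Fin 2 × ℤˣ)} (hw : degWeight α (wordDeg w) = 0) {μ : ℂ}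
    (hs : (wordNorm α p w).eval (μ + degWeight α (wordDeg s)) ≠ 0) (j : ℕ) :
    (wordNorm α p (wordStar s ++ (wordPow w j ++ s))).rootMultiplicity μ
      = (wordNorm α p (wordStar s ++ s)).rootMultiplicity μ := by
  set δ := degWeight α (wordDeg s)
  have h1 : wordNorm α p (wordStar s ++ (wordPow w j ++ s))
      = ((wordNorm α p w).comp (X + C δ)) ^ j * wordNorm α p (wordStar s ++ s) := by
    rw [wordNorm_append, wordNorm_append, wordNorm_append, wordNorm_wordPow p hw, wordDeg_append,
      wordDeg_wordPow, map_add, map_nsmul, hw, smul_zero, zero_add, pow_comp, mul_left_comm]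
  have h2 : ((wordNorm α p w).comp (X + C δ)) ^ j * wordNorm α p (wordStar s ++ s) ≠ 0 :=
    h1 ▸ wordNorm_ne_zero hp _
  rw [h1, rootMultiplicity_mul h2, rootMultiplicity_eq_zero, zero_add]
  simpa [IsRoot] using fun h => absurd h hs

/-- A word `w` of weight zero for which `N(w)` vanishes at `μ` is nilpotent modulo `H - μ`. The
words `w^j` and `z = s* w^j s`, where `s` leads from `μ` to a weight at which `N(w)` is nonzero, are
related by `N(z)(H) w^j = r(H) z` with `r² = N(z) N(w)^j`. The order of `N(z)` at `μ` is independent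
of `j`, so the order of `r` at `μ` exceeds it once `j` is large. -/
theorem exists_word_pow_eq {α : Fin 2 → ℂ} (hα : α ≠ 0) {p : Fin 2 → ℂ[X]}
    (hp : ∀ i, p i ≠ 0) {w : List (Fin 2 × ℤˣ)} (hw : degWeight α (wordDeg w) = 0) {μ : ℂ}
    (hμ : (wordNorm α p w).eval μ = 0) :
    ∃ j, ∃ c ∈ cyclicSubalgebra α p, word α p w ^ j = evalH α p (X - C μ) * c := by
  cases subsingleton_or_nontrivial (Alg α p)
  · exact ⟨0, 0, zero_mem _, Subsingleton.elim _ _⟩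
  obtain ⟨s, hs⟩ := exists_eval_add_degWeight_ne_zero hα (wordNorm_ne_zero hp w) μ
  set d := (wordNorm α p (wordStar s ++ s)).rootMultiplicity μ
  let z := wordStar s ++ (wordPow w (d + 1) ++ s)
  have hwj : degWeight α (wordDeg (wordPow w (d + 1))) = 0 := by
    rw [wordDeg_wordPow, map_nsmul, hw, smul_zero]
  have hzd : wordDeg (wordPow w (d + 1)) = wordDeg z := by simp [z]
  have hz : degWeight α (wordDeg z) = 0 := hzd ▸ hwj
  obtain ⟨r, h1, h2, h3⟩ := exists_evalH_mul_word_eq p hwj hzd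
  have hNz : (wordNorm α p z).rootMultiplicity μ = d :=
    rootMultiplicity_wordNorm_conj hp hw hs (d + 1)
  have hr : r * r = wordNorm α p z * wordNorm α p w ^ (d + 1) := by
    apply evalH_injective α p
    rw [← wordNorm_wordPow p hw, map_mul, map_mul]
    calc evalH α p r * evalH α p r
        = word α p z * word α p (wordStar (wordPow w (d + 1))) *
            (word α p (wordPow w (d + 1)) * word α p (wordStar z)) := by rw [h2, h3]
      _ = word α p z * evalH α p (wordNorm α p (wordPow w (d + 1))) * word α p (wordStar z) := by
        rw [← word_wordStar_mul]; simp only [mul_assoc]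
      _ = evalH α p (wordNorm α p (wordPow w (d + 1))) *
            (word α p z * word α p (wordStar z)) := by
        rw [← (evalH_commute_word p hz _).eq, mul_assoc]
      _ = _ := by
        rw [(commute_word_wordStar hp hz).eq, word_wordStar_mul, ← map_mul, ← map_mul, mul_comm]
  have hr0 : r * r ≠ 0 := by
    rw [hr]
    exact mul_ne_zero (wordNorm_ne_zero hp _) (pow_ne_zero _ (wordNorm_ne_zero hp _))
  have hord : d + 1 ≤ r.rootMultiplicity μ := by
    have h4 : d + (d + 1) ≤ (r * r).rootMultiplicity μ := by
      rw [le_rootMultiplicity_iff hr0, hr, pow_add]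
      exact mul_dvd_mul (hNz ▸ pow_rootMultiplicity_dvd _ _)
        (pow_dvd_pow_of_dvd (dvd_iff_isRoot.mpr hμ) _)
    rw [rootMultiplicity_mul hr0] at h4
    omega
  obtain ⟨c, hc, h⟩ := exists_eq_evalH_mul (μ := μ) (wordNorm_ne_zero hp z)
    (by rw [hNz]; exact (pow_dvd_pow _ hord).trans (pow_rootMultiplicity_dvd _ _))
    (word_mem p hwj) (word_mem p hz) h1
  exact ⟨d + 1, c, hc, by rw [← word_wordPow, h]⟩

/-! ### The cyclic subquotients -/

variable {α} in
/-- The class in `𝒞_μ` of a word of weight zero. -/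
def cyclicWord (μ : ℂ) (w : List (Fin 2 × ℤˣ)) (hw : degWeight α (wordDeg w) = 0) :
    CyclicSubquotient α p μ :=
  Ideal.Quotient.mk _ ⟨word α p w, word_mem p hw⟩

variable {α p} in
theorem mem_cyclicIdeal_of_eq_evalH_mul {μ : ℂ} {x : cyclicSubalgebra α p} {c : Alg α p}
    (hc : c ∈ cyclicSubalgebra α p) (h : (x : Alg α p) = evalH α p (X - C μ) * c) :
    x ∈ cyclicIdeal α p μ := by
  have hx : x = cyclicElt α p μ * ⟨c, hc⟩ := by
    apply Subtype.ext
    rw [h, map_sub, aeval_X, aeval_C]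
    rfl
  rw [hx, cyclicElt_central]
  exact Ideal.mem_span_singleton'.mpr ⟨_, rfl⟩

theorem mk_evalH (μ : ℂ) (f : ℂ[X]) :
    Ideal.Quotient.mk (cyclicIdeal α p μ) ⟨evalH α p f, evalH_mem α p f⟩
      = algebraMap ℂ _ (f.eval μ) := by
  obtain ⟨q, hq⟩ := X_sub_C_dvd_sub_C_eval (a := μ) (p := f)
  refine Ideal.Quotient.eq.mpr (mem_cyclicIdeal_of_eq_evalH_mul (evalH_mem α p q) ?_)
  rw [← map_mul, ← hq, map_sub, aeval_C]
  rfl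

theorem mk_evalH_mul_word (μ : ℂ) (f : ℂ[X]) {w : List (Fin 2 × ℤˣ)}
    (hw : degWeight α (wordDeg w) = 0) (h : evalH α p f * word α p w ∈ cyclicSubalgebra α p) :
    Ideal.Quotient.mk (cyclicIdeal α p μ) ⟨evalH α p f * word α p w, h⟩
      = f.eval μ • cyclicWord p μ w hw := by
  rw [Algebra.smul_def, ← mk_evalH, cyclicWord, ← map_mul]
  rfl

theorem cyclicWord_wordStar_mul (μ : ℂ) {w : List (Fin 2 × ℤˣ)}
    (hw : degWeight α (wordDeg w) = 0) (hw' : degWeight α (wordDeg (wordStar w)) = 0) :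
    cyclicWord p μ (wordStar w) hw' * cyclicWord p μ w hw
      = algebraMap ℂ _ ((wordNorm α p w).eval μ) := by
  rw [← mk_evalH, cyclicWord, cyclicWord, ← map_mul]
  congr 1
  exact Subtype.ext (word_wordStar_mul α p w)

theorem isNilpotent_cyclicWord {α : Fin 2 → ℂ} (hα : α ≠ 0) {p : Fin 2 → ℂ[X]}
    (hp : ∀ i, p i ≠ 0) {w : List (Fin 2 × ℤˣ)} (hw : degWeight α (wordDeg w) = 0) {μ : ℂ}
    (hμ : (wordNorm α p w).eval μ = 0) : IsNilpotent (cyclicWord p μ w hw) := by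
  obtain ⟨j, c, hc, h⟩ := exists_word_pow_eq hα hp hw hμ
  exact ⟨j, by
    rw [cyclicWord, ← map_pow]
    exact Ideal.Quotient.eq_zero_iff_mem.mpr (mem_cyclicIdeal_of_eq_evalH_mul hc h)⟩

theorem cyclicSubquotient_mul_comm {m n : ℕ} (hmn : Nat.Coprime m n) {α : Fin 2 → ℂ}
    (hα : α ≠ 0) (hmnα : (m : ℂ) * α 0 + (n : ℂ) * α 1 = 0) {p : Fin 2 → ℂ[X]} (hp : ∀ i, p i ≠ 0)
    {μ : ℂ} (x y : CyclicSubquotient α p μ) : x * y = y * x := by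
  obtain ⟨x, rfl⟩ := Ideal.Quotient.mk_surjective x
  obtain ⟨y, rfl⟩ := Ideal.Quotient.mk_surjective y
  rw [← map_mul, cyclicSubalgebra_mul_comm hmn hα hmnα hp, map_mul]

variable {α p} in
theorem mem_span_of_mem_cyclicGrading {μ : ℂ} {g : Fin 2 → ℤ} {x : CyclicSubquotient α p μ}
    (hx : x ∈ cyclicGrading α p μ g) :
    x ∈ Submodule.span ℂ
      {y | ∃ (w : List (Fin 2 × ℤˣ)) (hw : degWeight α (wordDeg w) = 0), wordDeg w = g ∧
        cyclicWord p μ w hw = y} := by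
  obtain ⟨⟨a, hac⟩, ha, rfl⟩ := hx
  replace ha : a ∈ grading α p g := ha
  by_cases hg : degWeight α g = 0
  · have key : ∃ h : a ∈ cyclicSubalgebra α p, Ideal.Quotient.mk (cyclicIdeal α p μ) ⟨a, h⟩ ∈
        Submodule.span ℂ {y | ∃ (w : List (Fin 2 × ℤˣ)) (hw : degWeight α (wordDeg w) = 0),
          wordDeg w = g ∧ cyclicWord p μ w hw = y} := by
      clear hac
      replace ha := mem_span_of_mem_grading α p ha
      induction ha using Submodule.span_induction with
      | mem a ha =>
        obtain ⟨f, w, rfl, rfl⟩ := ha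
        refine ⟨mul_mem (evalH_mem α p f) (word_mem p hg), ?_⟩
        rw [mk_evalH_mul_word α p μ f hg]
        exact Submodule.smul_mem _ _ (Submodule.subset_span ⟨w, hg, rfl, rfl⟩)
      | zero => exact ⟨zero_mem _, Submodule.zero_mem _⟩
      | add a b _ _ ha hb => exact ⟨add_mem ha.1 hb.1, Submodule.add_mem _ ha.2 hb.2⟩
      | smul c a _ ha => exact ⟨Subalgebra.smul_mem _ ha.1 c, Submodule.smul_mem _ c ha.2⟩
    exact key.2
  · obtain rfl := eq_zero_of_mem_grading_of_mem ha hac hg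
    exact Submodule.zero_mem _

theorem isNilpotent_of_mem_span {A : Type*} [Ring A] [Algebra ℂ A]
    (hcomm : ∀ x y : A, x * y = y * x) {s : Set A} (hs : ∀ x ∈ s, IsNilpotent x)
    {x : A} (hx : x ∈ Submodule.span ℂ s) :
    IsNilpotent x := by
  induction hx using Submodule.span_induction with
  | mem x hx => exact hs x hx
  | zero => exact IsNilpotent.zero
  | add x y _ _ hx hy => exact Commute.isNilpotent_add (hcomm x y) hx hy
  | smul c x _ hx => exact hx.smul c

theorem isNilpotent_proj_of_linearOrder {ι A : Type*} [AddCommMonoid ι] [LinearOrder ι]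
    [IsOrderedCancelAddMonoid ι] [hι : DecidableEq ι] [CommRing A] [Algebra ℂ A]
    (𝒜 : ι → Submodule ℂ A) [GradedAlgebra 𝒜] {x : A} (hx : IsNilpotent x) (i : ι) :
    IsNilpotent (GradedAlgebra.proj 𝒜 i x) := by
  obtain rfl : hι = LinearOrder.toDecidableEq := Subsingleton.elim _ _
  exact (Ideal.IsHomogeneous.bot 𝒜).radical i hx

/-- In a commutative `ℤ²`-graded algebra the nilradical is homogeneous, because the lexicographic
order of `ℤ²` is linear. -/
theorem isNilpotent_proj {A : Type*} [CommRing A] [Algebra ℂ A]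
    (𝒜 : (Fin 2 → ℤ) → Submodule ℂ A) [GradedAlgebra 𝒜] {x : A} (hx : IsNilpotent x)
    (g : Fin 2 → ℤ) : IsNilpotent (GradedAlgebra.proj 𝒜 g x) :=
  @isNilpotent_proj_of_linearOrder (Fin 2 → ℤ) A _
    (inferInstanceAs (LinearOrder (Lex (Fin 2 → ℤ))))
    (inferInstanceAs (IsOrderedCancelAddMonoid (Lex (Fin 2 → ℤ)))) _ _ _ 𝒜 _ x hx g

theorem algebraMap_eq_zero_of_isNilpotent {A : Type*} [Ring A] [Algebra ℂ A] {t : ℂ}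
    (h : IsNilpotent (algebraMap ℂ A t)) : algebraMap ℂ A t = 0 := by
  cases subsingleton_or_nontrivial A
  · exact Subsingleton.elim _ _
  · rw [IsNilpotent.map_iff (FaithfulSMul.algebraMap_injective ℂ A)] at h
    rw [h.eq_zero, map_zero]

/-- If every component of a commutative `ℤ²`-graded algebra `A` with `A_0 = ℂ` either consists of
nilpotent elements or has a unit in the component of opposite degree, then the radical of the
gradation form is the nilradical. -/
theorem gradationRadical_eq_setOf_isNilpotent {A : Type*} [CommRing A] [Algebra ℂ A]
    (𝒜 : (Fin 2 → ℤ) → Submodule ℂ A) [GradedAlgebra 𝒜]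
    (h0 : ∀ x ∈ 𝒜 0, ∃ t : ℂ, x = algebraMap ℂ A t)
    (h : ∀ g, (∀ x ∈ 𝒜 g, IsNilpotent x) ∨ ∃ y ∈ 𝒜 (-g), IsUnit y) :
    gradationRadical 𝒜 = {x : A | IsNilpotent x} := by
  have key : ∀ z : A, IsNilpotent z → GradedAlgebra.proj 𝒜 0 z = 0 := by
    intro z hz
    have h1 := isNilpotent_proj 𝒜 hz 0
    obtain ⟨t, ht⟩ := h0 (GradedAlgebra.proj 𝒜 0 z) (SetLike.coe_mem _)
    rw [ht] at h1 ⊢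
    exact algebraMap_eq_zero_of_isNilpotent h1
  ext x
  constructor
  · intro hx
    classical
    change x ∈ nilradical A
    rw [← DirectSum.sum_support_decompose 𝒜 x]
    refine sum_mem fun g _ => mem_nilradical.mpr ?_
    rcases h g with hg | ⟨y, hy, hu⟩
    · exact hg _ (SetLike.coe_mem _)
    · -- pairing `x` with the unit `y` shows that the component of degree `g` vanishes
      have h1 := (hx y).1
      rw [gradationForm, GradedAlgebra.proj_apply] at h1
      have h2 := DirectSum.coe_decompose_mul_add_of_right_mem 𝒜 (i := g) (a := x) hy
      rw [add_neg_cancel, h1] at h2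
      rw [hu.mul_left_eq_zero.mp h2.symm]
      exact IsNilpotent.zero
  · intro hx y
    exact ⟨key _ (Commute.isNilpotent_mul_right (Commute.all _ _) hx),
      key _ (Commute.isNilpotent_mul_left (Commute.all _ _) hx)⟩

/-- The scalars are the elements of degree zero of `𝒞_μ`. -/
theorem exists_eq_algebraMap_of_mem_cyclicGrading {μ : ℂ} {x : CyclicSubquotient α p μ}
    (hx : x ∈ cyclicGrading α p μ 0) : ∃ t : ℂ, x = algebraMap ℂ _ t := by
  replace hx := mem_span_of_mem_cyclicGrading hx
  induction hx using Submodule.span_induction with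
  | mem x hx =>
    obtain ⟨w, hw, hd, rfl⟩ := hx
    obtain ⟨f, hf, -⟩ := exists_word_eq_evalH_and_wordStar α p w hd
    refine ⟨f.eval μ, ?_⟩
    rw [← mk_evalH, cyclicWord]
    congr 1
    exact Subtype.ext hf
  | zero => exact ⟨0, (RingHom.map_zero _).symm⟩
  | add x y _ _ hx hy =>
    obtain ⟨s, rfl⟩ := hx
    obtain ⟨t, rfl⟩ := hy
    exact ⟨s + t, (RingHom.map_add _ _ _).symm⟩
  | smul c x _ hx =>
    obtain ⟨t, rfl⟩ := hx
    exact ⟨c * t, by rw [RingHom.map_mul, Algebra.smul_def]⟩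

/-- The algebra `𝒞_μ` as a commutative ring. -/
abbrev cyclicCommRing {m n : ℕ} (hmn : Nat.Coprime m n) {α : Fin 2 → ℂ}
    (hα : α ≠ 0) (hmnα : (m : ℂ) * α 0 + (n : ℂ) * α 1 = 0) {p : Fin 2 → ℂ[X]} (hp : ∀ i, p i ≠ 0)
    (μ : ℂ) : CommRing (CyclicSubquotient α p μ) :=
  { (inferInstance : Ring (CyclicSubquotient α p μ)) with
    mul_comm := cyclicSubquotient_mul_comm hmn hα hmnα hp }

theorem gradationRadical_eq {m n : ℕ} (hmn : Nat.Coprime m n) {α : Fin 2 → ℂ}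
    (hα : α ≠ 0) (hmnα : (m : ℂ) * α 0 + (n : ℂ) * α 1 = 0) {p : Fin 2 → ℂ[X]} (hp : ∀ i, p i ≠ 0)
    (μ : ℂ) :
    gradationRadical (cyclicGrading α p μ) = {x : CyclicSubquotient α p μ | IsNilpotent x} := by
  have hcomm := cyclicSubquotient_mul_comm hmn hα hmnα hp (μ := μ)
  have h (g : Fin 2 → ℤ) : (∀ x ∈ cyclicGrading α p μ g, IsNilpotent x) ∨
      ∃ y ∈ cyclicGrading α p μ (-g), IsUnit y := by
    by_cases hnil : ∀ (w : List (Fin 2 × ℤˣ)), degWeight α (wordDeg w) = 0 → wordDeg w = g →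
        (wordNorm α p w).eval μ = 0
    · left
      intro x hx
      refine isNilpotent_of_mem_span hcomm ?_ (mem_span_of_mem_cyclicGrading hx)
      rintro _ ⟨w, hw, hd, rfl⟩
      exact isNilpotent_cyclicWord hα hp hw (hnil w hw hd)
    · right
      push Not at hnil
      obtain ⟨w, hw, rfl, hne⟩ := hnil
      have hw' : degWeight α (wordDeg (wordStar w)) = 0 := by
        rw [wordDeg_wordStar, map_neg, hw, neg_zero]
      refine ⟨cyclicWord p μ (wordStar w) hw', ?_, ?_⟩
      · rw [← wordDeg_wordStar]
        exact ⟨⟨_, word_mem p hw'⟩, word_mem_grading α p (wordStar w), rfl⟩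
      · have hu : IsUnit (cyclicWord p μ (wordStar w) hw' * cyclicWord p μ w hw) := by
          rw [cyclicWord_wordStar_mul α p μ hw hw']
          exact (IsUnit.mk0 _ hne).map (algebraMap ℂ (CyclicSubquotient α p μ))
        exact ((Commute.isUnit_mul_iff (hcomm _ _)).mp hu).1
  exact @gradationRadical_eq_setOf_isNilpotent _ (cyclicCommRing hmn hα hmnα hp μ) _
    (cyclicGrading α p μ) _ (fun x => exists_eq_algebraMap_of_mem_cyclicGrading α p) h

/-! ### Simple weight modules -/

variable {α p}
variable {M : Type*} [AddCommGroup M] [Module ℂ M] [Module (Alg α p) M]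
  [IsScalarTower ℂ (Alg α p) M]

theorem mem_weightSpace_iff {μ : ℂ} {v : M} :
    v ∈ weightSpace α p M μ ↔ genH α p • v = μ • v := by
  rw [weightSpace, Module.End.mem_eigenspace_iff]
  rfl

theorem evalH_smul_of_mem_weightSpace {μ : ℂ} {v : M} (hv : v ∈ weightSpace α p M μ) (f : ℂ[X]) :
    evalH α p f • v = f.eval μ • v := by
  rw [mem_weightSpace_iff] at hv
  induction f using Polynomial.induction_on' with
  | add f g hf hg => rw [map_add, add_smul, hf, hg, eval_add, add_smul]
  | monomial k c =>
    have hk : ∀ k : ℕ, genH α p ^ k • v = μ ^ k • v := by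
      intro k
      induction k with
      | zero => simp
      | succ k ih =>
        rw [pow_succ', mul_smul, ih, ← algebraMap_smul (Alg α p) (μ ^ k), smul_smul,
          ← Algebra.commutes, mul_smul, hv, algebraMap_smul, smul_smul, pow_succ]
    rw [aeval_monomial, mul_smul, hk, algebraMap_smul, smul_smul, eval_monomial]

theorem smul_mem_weightSpace {g : Fin 2 → ℤ} {a : Alg α p} (ha : a ∈ grading α p g) {μ : ℂ} {v : M}
    (hv : v ∈ weightSpace α p M μ) : a • v ∈ weightSpace α p M (μ + degWeight α g) := by
  rw [mem_weightSpace_iff] at hv ⊢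
  rw [← mul_smul, genH_mul_of_mem_grading ha, mul_smul, add_smul, hv, algebraMap_smul, ← add_smul,
    ← algebraMap_smul (Alg α p), ← mul_smul, ← Algebra.commutes, mul_smul, algebraMap_smul]

/-- The components of `a` that carry the weight `ν` to the weight `μ` suffice to obtain a vector of
weight `μ` from a vector of weight `ν` by applying `a`. -/
theorem exists_sum_proj_smul_eq {μ ν : ℂ} {u v : M} (hu : u ∈ weightSpace α p M ν)
    (hv : v ∈ weightSpace α p M μ) {a : Alg α p} (ha : a • u = v) :
    ∃ S : Finset (Fin 2 → ℤ), (∀ g ∈ S, ν + degWeight α g = μ) ∧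
      (∑ g ∈ S, GradedAlgebra.proj (grading α p) g a) • u = v := by
  classical
  let d : (Fin 2 → ℤ) → Alg α p := fun g => GradedAlgebra.proj (grading α p) g a
  let T := (DirectSum.decompose (grading α p) a).support
  have hd : ∀ g, d g • u ∈ weightSpace α p M (ν + degWeight α g) := fun g =>
    smul_mem_weightSpace (SetLike.coe_mem _) hu
  have hsum : ∑ g ∈ T, d g • u = v := by
    rw [← Finset.sum_smul, ← ha]
    congr 1
    exact DirectSum.sum_support_decompose (grading α p) a
  refine ⟨T.filter fun g => ν + degWeight α g = μ, fun g hg => (Finset.mem_filter.mp hg).2, ?_⟩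
  rw [Finset.sum_smul]
  change ∑ g ∈ T with ν + degWeight α g = μ, d g • u = v
  rw [← Finset.sum_filter_add_sum_filter_not T fun g => ν + degWeight α g = μ] at hsum
  have h1 : ∑ g ∈ T with ν + degWeight α g = μ, d g • u ∈ weightSpace α p M μ := by
    refine Submodule.sum_mem _ fun g hg => ?_
    have h := hd g
    rwa [(Finset.mem_filter.mp hg).2] at h
  have h2 : ∑ g ∈ T with ¬ν + degWeight α g = μ, d g • u ∈
      ⨆ κ, ⨆ _ : κ ≠ μ, weightSpace α p M κ := by
    refine Submodule.sum_mem _ fun g hg => ?_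
    exact Submodule.mem_iSup_of_mem _
      (Submodule.mem_iSup_of_mem (Finset.mem_filter.mp hg).2 (hd g))
  have h3 : ∑ g ∈ T with ¬ν + degWeight α g = μ, d g • u = 0 := by
    have hdisj := Module.End.eigenspaces_iSupIndep (Algebra.lsmul ℂ ℂ M (genH α p)) μ
    refine Submodule.disjoint_def.mp hdisj _ ?_ h2
    rw [← eq_sub_iff_add_eq'] at hsum
    rw [hsum]
    exact Submodule.sub_mem _ hv h1
  rwa [h3, add_zero] at hsum

/-- If `N(w)` vanishes at `μ`, then `a w` is nilpotent modulo `H - μ` whenever all components of `a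
w` have weight zero. -/
theorem exists_isNilpotent_mk_mul_word (hα : α ≠ 0) (hp : ∀ i, p i ≠ 0)
    (hcomm : ∀ μ, ∀ x y : CyclicSubquotient α p μ, x * y = y * x) {μ : ℂ} {w : List (Fin 2 × ℤˣ)}
    (hμ : (wordNorm α p w).eval μ = 0) {a : Alg α p}
    (ha : a ∈ Submodule.span ℂ {b | ∃ (f : ℂ[X]) (v : List (Fin 2 × ℤˣ)),
      degWeight α (wordDeg v + wordDeg w) = 0 ∧ evalH α p f * word α p v = b}) :
    ∃ h : a * word α p w ∈ cyclicSubalgebra α p,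
      IsNilpotent (Ideal.Quotient.mk (cyclicIdeal α p μ) ⟨a * word α p w, h⟩) := by
  induction ha using Submodule.span_induction with
  | mem a ha =>
    obtain ⟨f, v, hg, rfl⟩ := ha
    rw [← wordDeg_append] at hg
    rw [mul_assoc, ← word_append]
    refine ⟨mul_mem (evalH_mem α p f) (word_mem p hg), ?_⟩
    rw [mk_evalH_mul_word α p μ f hg]
    refine (isNilpotent_cyclicWord hα hp hg ?_).smul _
    rw [wordNorm_append, eval_mul, hμ, mul_zero]
  | zero =>
    rw [zero_mul]
    exact ⟨zero_mem _, IsNilpotent.zero⟩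
  | add a b _ _ ha hb =>
    obtain ⟨ha, ha'⟩ := ha
    obtain ⟨hb, hb'⟩ := hb
    rw [add_mul]
    exact ⟨add_mem ha hb, Commute.isNilpotent_add (hcomm _ _ _) ha' hb'⟩
  | smul c a _ ha =>
    obtain ⟨ha, ha'⟩ := ha
    rw [smul_mul_assoc]
    exact ⟨Subalgebra.smul_mem _ ha c, ha'.smul c⟩

theorem noInnerBreaks_of_isSimpleModule (hα : α ≠ 0) (hp : ∀ i, p i ≠ 0)
    (hcomm : ∀ μ, ∀ x y : CyclicSubquotient α p μ, x * y = y * x) [IsSimpleModule (Alg α p) M] :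
    NoInnerBreaks α p M := by
  rintro μ - r w ⟨v, hv, hne⟩ ⟨f, hf⟩
  have ha : monomialElt α p r w = evalH α p r * word α p w := rfl
  have hs : monomialStar α p r w = word α p (wordStar w) * evalH α p r := by
    rw [monomialStar, word, wordStar, List.map_map]; rfl
  have hwv := smul_mem_weightSpace (word_mem_grading α p w) hv
  set δ := degWeight α (wordDeg w)
  have hu : word α p w • v ≠ 0 := by
    intro h0
    rw [ha, mul_smul, h0, smul_zero] at hne
    exact hne rfl
  have hr : r.eval (μ + δ) ≠ 0 := by
    intro h0
    rw [ha, mul_smul, evalH_smul_of_mem_weightSpace hwv, h0, zero_smul] at hne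
    exact hne rfl
  -- since `a* a` kills `v` and `r` does not vanish at the weight of `w v`, `w* w` kills `v`
  have hN : (wordNorm α p w).eval μ = 0 := by
    have h1 : (monomialStar α p r w * monomialElt α p r w) • v = 0 := by
      rw [hf, evalH_smul_of_mem_weightSpace hv]; simp
    have h2 : (monomialStar α p r w * monomialElt α p r w) • v
        = (r.eval (μ + δ) * r.eval (μ + δ) * (wordNorm α p w).eval μ) • v := by
      rw [hs, ha, mul_assoc, ← mul_assoc (evalH α p r), ← map_mul, mul_smul, mul_smul,
        evalH_smul_of_mem_weightSpace hwv, eval_mul, smul_comm, ← mul_smul (word α p _),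
        word_wordStar_mul, evalH_smul_of_mem_weightSpace hv, smul_smul]
    rw [h1] at h2
    have hv0 : v ≠ 0 := by rintro rfl; exact hu (smul_zero _)
    have h3 := (smul_eq_zero.mp h2.symm).resolve_right hv0
    exact (mul_eq_zero.mp h3).resolve_left (mul_ne_zero hr hr)
  obtain ⟨b, hb⟩ := IsSimpleModule.toSpanSingleton_surjective (Alg α p) hu v
  change b • word α p w • v = v at hb
  obtain ⟨S, hS, hbS⟩ := exists_sum_proj_smul_eq hwv hv hb
  -- hence an element that carries `w v` back to `v` gives an element of `𝒞` that fixes `v` and is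
  -- nilpotent modulo `H - μ`
  obtain ⟨hc, k, hk⟩ := exists_isNilpotent_mk_mul_word hα hp hcomm hN
    (a := ∑ g ∈ S, GradedAlgebra.proj (grading α p) g b) (by
      refine Submodule.sum_mem _ fun g hg => ?_
      refine Submodule.span_mono ?_ (mem_span_of_mem_grading α p (SetLike.coe_mem _))
      rintro _ ⟨q, u, rfl, rfl⟩
      have h := hS _ hg
      rw [add_assoc, add_eq_left] at h
      exact ⟨q, u, by rw [map_add, add_comm, h], rfl⟩)
  set c := (∑ g ∈ S, GradedAlgebra.proj (grading α p) g b) * word α p w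
  rw [← map_pow, Ideal.Quotient.eq_zero_iff_mem] at hk
  obtain ⟨d, hd⟩ := Ideal.mem_span_singleton'.mp hk
  have h1 : c ^ k • v = v := by
    clear hk hd
    induction k with
    | zero => simp
    | succ k ih => rw [pow_succ, mul_smul, mul_smul, hbS, ih]
  have h2 : c ^ k • v = 0 := by
    have h3 : c ^ k = d * (genH α p - algebraMap ℂ _ μ) := (congrArg Subtype.val hd).symm
    rw [h3, mul_smul, sub_smul, mem_weightSpace_iff.mp hv, algebraMap_smul, sub_self, smul_zero]
  rw [← h1, h2, smul_zero] at hu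
  exact hu rfl

theorem VertexConfiguration.P_ne_zero {α : Fin 2 → ℂ} (L : VertexConfiguration α) (i : Fin 2) :
    L.P i ≠ 0 :=
  Finset.prod_ne_zero_iff.mpr fun e _ => pow_ne_zero _ (X_sub_C_ne_zero e)

end KleinianFiber

end

theorem mainTheorem4 (m n : ℕ) (hmn : Nat.Coprime m n) (α : Fin 2 → ℂ) (hα : α ≠ 0)
    (hmnα : (m : ℂ) * α 0 + (n : ℂ) * α 1 = 0) (L : KleinianFiber.VertexConfiguration α) :
    (∀ μ ∈ KleinianFiber.faceLattice α,
      (∀ x y : KleinianFiber.CyclicSubquotient α L.P μ, x * y = y * x) ∧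
      KleinianFiber.gradationRadical (KleinianFiber.cyclicGrading α L.P μ)
        = {x : KleinianFiber.CyclicSubquotient α L.P μ | IsNilpotent x}) ∧
    (∀ (M : Type*) [AddCommGroup M] [Module ℂ M] [Module (KleinianFiber.Alg α L.P) M]
      [IsScalarTower ℂ (KleinianFiber.Alg α L.P) M],
      IsSimpleModule (KleinianFiber.Alg α L.P) M → KleinianFiber.IsWeightModule α L.P M →
        KleinianFiber.NoInnerBreaks α L.P M) := by
  have hcomm : ∀ μ, ∀ x y : KleinianFiber.CyclicSubquotient α L.P μ, x * y = y * x := fun μ =>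
    KleinianFiber.cyclicSubquotient_mul_comm hmn hα hmnα L.P_ne_zero
  exact ⟨fun μ _ => ⟨hcomm μ, KleinianFiber.gradationRadical_eq hmn hα hmnα L.P_ne_zero μ⟩,
    fun M _ _ _ _ _ _ => KleinianFiber.noInnerBreaks_of_isSimpleModule hα L.P_ne_zero hcomm⟩
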